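/- Let $k$ be a field and let $(R,<)$ be a totally ordered set that has a countable subset which is dense in the order topology. A persistence module $V$ is a functor from $R$ to the category of $k$-vector spaces, with structure maps $\rho_{ts}:V_s\to V_t$ for $s\le t$. Direct sums of persistence modules are formed pointwise. An interval is a non-empty subset $I\subseteq R$ such that $r\le s\le t$ with $r,t\in I$ implies $s\in I$. Its interval module $k_I$ has $(k_I)_t=k$ for $t\in I$, $(k_I)_t=0$ for $t\notin I$, and $\rho_{ts}=1$ for $s\le t$ in $I$. Let $V$ be a persistence module with the descending chain condition on images and kernels: for all $t\ge s_1>s_2>\cdots$ in $R$ the chain $\operatorname{Im}\rho_{ts_1}\supseteq \operatorname{Im}\rho_{ts_2}\supseteq\cdots$ stabilizes, and for all $t\le\cdots<r_2<r_1$ in $R$ the chain $\operatorname{Ker}\rho_{r_1t}\supseteq\operatorname{Ker}\rho_{r_2t}\supseteq\cdots$ stabilizes. For an interval $I$ put $\ell^-=\{t: t<s\ \forall s\in I\}$, $\ell^+=\{t: t\ge s\text{ for some }s\in I\}$, $u^+=\{t: t>s\ \forall s\in I\}$, $u^-=\{t: t\le s\text{ for some }s\in I\}$. For $t\in I$ let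 $$\operatorname{Im}^-_{\ell t}=\bigcup_{s\in \ell^-}\operatorname{Im}\rho_{ts},\quad \operatorname{Im}^+_{\ell t}=\bigcap_{s\in \ell^+,\,s\le t}\operatorname{Im}\rho_{ts},\quad \operatorname{Ker}^-_{ut}=\bigcup_{r\in u^-,\,t\le r}\operatorname{Ker}\rho_{rt},\quad \operatorname{Ker}^+_{ut}=\bigcap_{r\in u^+}\operatorname{Ker}\rho_{rt},$$ where $\operatorname{Im}^-_{\ell t}=0$ if $\ell^-=\emptyset$ and $\operatorname{Ker}^+_{ut}=V_t$ if $u^+=\emptyset$. Define $$V^-_{It}=(\operatorname{Im}^-_{\ell t}\cap\operatorname{Ker}^+_{ut})+(\operatorname{Im}^+_{\ell t}\cap\operatorname{Ker}^-_{ut}),\qquad V^+_{It}=\operatorname{Im}^+_{\ell t}\cap\operatorname{Ker}^+_{ut},$$ and let $V^\pm_I=\varprojlim_{t\in I}V^\pm_{It}$ be the inverse limits with respect to the maps induced by the $\rho_{ts}$, so that $V^-_I\subseteq V^+_I$. Then $V$ is a direct sum of interval modules, every interval module is indecomposable, and for every interval $I$ the multiplicity of $k_I$ as a summand of $V$ is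 $\dim_k(V^+_I/V^-_I)$. That is, for every decomposition $V\cong\bigoplus_{\lambda\in\Lambda}M_\lambda$ into indecomposable persistence modules, the cardinal number of the set $\{\lambda\in\Lambda: M_\lambda\cong k_I\}$ equals $\dim_k (V^+_I/V^-_I)$ (as cardinals). -/

import Mathlib

open CategoryTheory

universe u v w

namespace Persistence

section Modules

variable {k : Type u} [Field k] {R : Type v} [LinearOrder R]

/-- The structure map `ρ_{ts} : V_s → V_t`, for `s ≤ t`, of a persistence module, that is, of a
functor from the ordered set `R` to vector spaces over `k`. -/
def rho (V : R ⥤ ModuleCat.{u} k) {s t : R} (h : s ≤ t) : V.obj s →ₗ[k] V.obj t :=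
  (V.map (homOfLE h)).hom

/-- The descending chain condition on images and kernels. -/
structure HasDCC (V : R ⥤ ModuleCat.{u} k) : Prop where
  images : ∀ (t : R) (s : ℕ → R), StrictAnti s → ∀ hs : ∀ n, s n ≤ t,
    ∃ N, ∀ n, N ≤ n → LinearMap.range (rho V (hs n)) = LinearMap.range (rho V (hs N))
  kernels : ∀ (t : R) (r : ℕ → R), StrictAnti r → ∀ hr : ∀ n, t ≤ r n,
    ∃ N, ∀ n, N ≤ n → LinearMap.ker (rho V (hr n)) = LinearMap.ker (rho V (hr N))

/-- The maps `ι i : M i ⟶ V` exhibit `V` as the direct sum of the persistence modules `M i`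
(direct sums of persistence modules being formed pointwise). -/
def IsDirectSum {Λ : Type w} (M : Λ → (R ⥤ ModuleCat.{u} k)) (V : R ⥤ ModuleCat.{u} k)
    (ι : ∀ i, M i ⟶ V) : Prop :=
  ∀ t : R, Function.Bijective
    (by classical exact
      DirectSum.toModule k Λ (V.obj t) (fun i => ((ι i).app t).hom) :
      DirectSum Λ (fun i => ((M i).obj t : Type u)) →ₗ[k] V.obj t)

end Modules

/-- A cut `c = (c⁻, c⁺)` of `R`. -/
structure Cut (R : Type v) [LinearOrder R] where
  lower : Set R
  upper : Set R
  union_eq : lower ∪ upper = Set.univ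
  lt_of_mem : ∀ s ∈ lower, ∀ t ∈ upper, s < t

/-- An interval of `R`: a non-empty subset `I` such that `r ≤ s ≤ t` with `r, t ∈ I` implies
`s ∈ I`. -/
structure IntervalSet (R : Type v) [LinearOrder R] where
  carrier : Set R
  nonempty : carrier.Nonempty
  ordConnected : carrier.OrdConnected

section Intervals

variable {R : Type v} [LinearOrder R]

/-- The cut `ℓ` determined by an interval `I`. -/
def IntervalSet.lowerCut (I : IntervalSet R) : Cut R where
  lower := {t | ∀ s ∈ I.carrier, t < s}
  upper := {t | ∃ s ∈ I.carrier, s ≤ t}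
  union_eq := by
    ext t
    simp only [Set.mem_union, Set.mem_ofPred_eq, Set.mem_univ, iff_true]
    by_contra! h
    obtain ⟨⟨s, hs, hst⟩, h2⟩ := h
    exact absurd (h2 s hs) (not_lt.2 hst)
  lt_of_mem := by
    rintro s hs t ⟨r, hr, hrt⟩
    exact (hs r hr).trans_le hrt

/-- The cut `u` determined by an interval `I`. -/
def IntervalSet.upperCut (I : IntervalSet R) : Cut R where
  lower := {t | ∃ s ∈ I.carrier, t ≤ s}
  upper := {t | ∀ s ∈ I.carrier, s < t}
  union_eq := by
    ext t
    simp only [Set.mem_union, Set.mem_ofPred_eq, Set.mem_univ, iff_true]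
    by_contra! h
    obtain ⟨h2, ⟨s, hs, hst⟩⟩ := h
    exact absurd (h2 s hs) (not_lt.2 hst)
  lt_of_mem := by
    rintro s ⟨r, hr, hsr⟩ t ht
    exact hsr.trans_lt (ht r hr)

end Intervals

section IntervalModule

variable (k : Type u) [Field k] {R : Type v} [LinearOrder R]

open Classical in
/-- The vector space `k` if `t ∈ I`, and `0` otherwise. -/
noncomputable def intervalFibre (I : IntervalSet R) (t : R) : Submodule k k :=
  if t ∈ I.carrier then ⊤ else ⊥

variable {k}

theorem eq_zero_of_mem_intervalFibre {I : IntervalSet R} {t : R} (ht : t ∉ I.carrier) {x : k}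
    (hx : x ∈ intervalFibre k I t) : x = 0 := by
  simpa [intervalFibre, ht] using hx

theorem mem_intervalFibre {I : IntervalSet R} {t : R} (ht : t ∈ I.carrier) (x : k) :
    x ∈ intervalFibre k I t := by
  simp [intervalFibre, ht]

variable (k)

open Classical in
/-- The identity of `k` if `t ∈ I` (and `s ∈ I`), and `0` otherwise. -/
noncomputable def intervalMap (I : IntervalSet R) (s t : R) :
    intervalFibre k I s →ₗ[k] intervalFibre k I t where
  toFun x := if h : t ∈ I.carrier then ⟨x.1, mem_intervalFibre h x.1⟩ else 0
  map_add' x y := by split_ifs <;> simp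
  map_smul' c x := by split_ifs <;> simp

/-- The interval module `k_I`. -/
noncomputable def intervalModule (I : IntervalSet R) : R ⥤ ModuleCat.{u} k where
  obj t := ModuleCat.of k (intervalFibre k I t)
  map {s t} _ := ModuleCat.ofHom (intervalMap k I s t)
  map_id t := by
    ext x
    by_cases h : t ∈ I.carrier
    · simp [intervalMap, h]
    · simpa [intervalMap, h] using (eq_zero_of_mem_intervalFibre h x.2).symm
  map_comp {r s t} f g := by
    ext x
    by_cases ht : t ∈ I.carrier
    · by_cases hs : s ∈ I.carrier
      · simp [intervalMap, hs, ht]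
      · have hr : r ∉ I.carrier := fun hr => hs (I.ordConnected.out hr ht ⟨leOfHom f, leOfHom g⟩)
        have hx := eq_zero_of_mem_intervalFibre hr x.2
        simp [intervalMap, hs, ht, hx]
    · simp [intervalMap, ht]

end IntervalModule

section Filtration

variable {k : Type u} [Field k] {R : Type v} [LinearOrder R] (V : R ⥤ ModuleCat.{u} k)

/-- `Im⁻_{ct}`, for `t ∈ c⁺`: the union of the chain of the images of `ρ_{ts}` with `s ∈ c⁻`,
and `0` if `c⁻` is empty. -/
def imMinus (c : Cut R) (t : R) : Submodule k (V.obj t) :=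
  ⨆ (s : R) (_ : s ∈ c.lower) (h : s ≤ t), LinearMap.range (rho V h)

/-- `Im⁺_{ct}`, for `t ∈ c⁺`: the intersection of the images of `ρ_{ts}` with `s ∈ c⁺`, `s ≤ t`. -/
def imPlus (c : Cut R) (t : R) : Submodule k (V.obj t) :=
  ⨅ (s : R) (_ : s ∈ c.upper) (h : s ≤ t), LinearMap.range (rho V h)

/-- `Ker⁻_{ct}`, for `t ∈ c⁻`: the union of the chain of the kernels of `ρ_{rt}` with `r ∈ c⁻`,
`t ≤ r`. -/
def kerMinus (c : Cut R) (t : R) : Submodule k (V.obj t) :=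
  ⨆ (r : R) (_ : r ∈ c.lower) (h : t ≤ r), LinearMap.ker (rho V h)

/-- `Ker⁺_{ct}`, for `t ∈ c⁻`: the intersection of the kernels of `ρ_{rt}` with `r ∈ c⁺`,
and `V_t` if `c⁺` is empty. -/
def kerPlus (c : Cut R) (t : R) : Submodule k (V.obj t) :=
  ⨅ (r : R) (_ : r ∈ c.upper) (h : t ≤ r), LinearMap.ker (rho V h)

/-- `V⁻_{It}`, for `t ∈ I`. -/
def pointMinus (I : IntervalSet R) (t : R) : Submodule k (V.obj t) :=
  (imMinus V I.lowerCut t ⊓ kerPlus V I.upperCut t) ⊔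
    (imPlus V I.lowerCut t ⊓ kerMinus V I.upperCut t)

/-- `V⁺_{It}`, for `t ∈ I`. -/
def pointPlus (I : IntervalSet R) (t : R) : Submodule k (V.obj t) :=
  imPlus V I.lowerCut t ⊓ kerPlus V I.upperCut t

/-- The inverse limit over `t ∈ I`, with the transition maps induced by `ρ_{ts}`, of subspaces
`F t` of `V_t`: the space of families `(x_t)` with `x_t ∈ F t` and `ρ_{ts} x_s = x_t`
for `s ≤ t` in `I`. -/
def inverseLimit (I : IntervalSet R) (F : ∀ t : R, Submodule k (V.obj t)) :
    Submodule k (∀ t : I.carrier, V.obj t.1) where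
  carrier := {x | (∀ t : I.carrier, x t ∈ F t.1) ∧
    ∀ (s t : I.carrier) (h : s.1 ≤ t.1), rho V h (x s) = x t}
  zero_mem' := by simp
  add_mem' := by
    rintro x y ⟨hx, hx'⟩ ⟨hy, hy'⟩
    exact ⟨fun t => add_mem (hx t) (hy t), fun s t h => by simp [hx' s t h, hy' s t h]⟩
  smul_mem' := by
    rintro c x ⟨hx, hx'⟩
    exact ⟨fun t => Submodule.smul_mem _ c (hx t), fun s t h => by simp [hx' s t h]⟩

/-- `V⁻_I`, the inverse limit of the spaces `V⁻_{It}`. -/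
def limMinus (I : IntervalSet R) : Submodule k (∀ t : I.carrier, V.obj t.1) :=
  inverseLimit V I (pointMinus V I)

/-- `V⁺_I`, the inverse limit of the spaces `V⁺_{It}`. -/
def limPlus (I : IntervalSet R) : Submodule k (∀ t : I.carrier, V.obj t.1) :=
  inverseLimit V I (pointPlus V I)

/-- The quotient space `V⁺_I / V⁻_I`. -/
abbrev limQuotient (I : IntervalSet R) : Type (max u v) :=
  limPlus V I ⧸ (limMinus V I).submoduleOf (limPlus V I)

end Filtration

end Persistence

namespace Persistence

/-! ### Functoriality of the structure maps, and monotonicity of their images and kernels. -/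

section StructureMaps

variable {k : Type u} [Field k] {R : Type v} [LinearOrder R] (V : R ⥤ ModuleCat.{u} k)

/-! The quotient V⁺_{It}/V⁻_{It} isolates the part of V_t that lives exactly on the interval I. The
chain condition turns each Im⁺ at a point of I into an honest image, so ρ_{ts} maps V^±_{Is} onto
V^±_{It} for s ≤ t in I. Since Ker ρ_{ts} lies in Ker⁻_{us}, the induced maps of quotients are
bijective. By separability I has a countable coinitial sequence, so vectors of V⁺_{It} lift to V⁺_I
as in the Mittag-Leffler argument (`exists_limPlus_apply_eq`). Hence V⁺_I/V⁻_I is V⁺_{It}/V⁻_{It}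
for every t in I.

An element of V⁺_I is the same as a morphism k_I → V. Lifts of a basis of V⁺_I/V⁻_I, taken for all
I, decompose V once their values at each t form a basis of V_t. They are independent because the
sections Im⁻ + V⁻ ≤ Im⁻ + V⁺ of different intervals are disjoint (`sections_disjoint`,
`linearIndependent_of_sections`). They span because every proper subspace X of V_t contains V⁻_{It}
but not V⁺_{It} for some I (`exists_pointMinus_le_and_not_pointPlus_le`).

For the multiplicity, a decomposition into interval modules gives a basis of V_t in which all images
and kernels are coordinate subspaces. So V⁺_{It} and V⁻_{It} are too, and the basis vectors in the
first but not the second come from the summands k_I. An arbitrary indecomposable summand is a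
retract of V, inherits the chain condition, and is therefore an interval module by the existence
part. -/

theorem rho_refl {t : R} (h : t ≤ t) (x : V.obj t) : rho V h x = x := by
  simp [rho]

theorem rho_rho {r s t : R} (hrs : r ≤ s) (hst : s ≤ t) (x : V.obj r) :
    rho V hst (rho V hrs x) = rho V (hrs.trans hst) x := by
  have : homOfLE (hrs.trans hst) = homOfLE hrs ≫ homOfLE hst := rfl
  rw [rho, rho, rho, this, V.map_comp]
  rfl

theorem rho_comp {r s t : R} (hrs : r ≤ s) (hst : s ≤ t) :
    rho V hst ∘ₗ rho V hrs = rho V (hrs.trans hst) :=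
  LinearMap.ext fun x => rho_rho V hrs hst x

theorem hom_rho {V} {W : R ⥤ ModuleCat.{u} k} (f : V ⟶ W) {s t : R} (h : s ≤ t) (x : V.obj s) :
    (f.app t).hom (rho V h x) = rho W h ((f.app s).hom x) := by
  have := f.naturality (homOfLE h)
  exact congrArg (fun g => g.hom x) this

theorem range_rho_mono {r s t : R} (hrs : r ≤ s) (hst : s ≤ t) :
    LinearMap.range (rho V (hrs.trans hst)) ≤ LinearMap.range (rho V hst) := by
  rw [← rho_comp V hrs hst]
  exact LinearMap.range_comp_le_range _ _

theorem ker_rho_mono {r s t : R} (hrs : r ≤ s) (hst : s ≤ t) :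
    LinearMap.ker (rho V hrs) ≤ LinearMap.ker (rho V (hrs.trans hst)) := by
  rw [← rho_comp V hrs hst]
  exact LinearMap.ker_le_ker_comp _ _

end StructureMaps

/-- A monotone map from a linear order that is eventually constant on strictly decreasing sequences
attains its least value on every non-empty set. -/
theorem exists_least_value {P α : Type*} [LinearOrder P] [PartialOrder α] {f : P → α}
    (hf : Monotone f)
    (h : ∀ s : ℕ → P, StrictAnti s → ∃ N, ∀ n, N ≤ n → f (s n) = f (s N))
    {S : Set P} (hS : S.Nonempty) : ∃ a ∈ S, ∀ b ∈ S, f a ≤ f b := by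
  -- A descending chain for the pulled-back order is strictly decreasing in P, because a monotone
  -- map on a linear order reflects `<`.
  have hwf : WellFounded fun a b : P => f a < f b := by
    rw [wellFounded_iff_isEmpty_descending_chain]
    refine ⟨fun ⟨g, hg⟩ => ?_⟩
    obtain ⟨N, hN⟩ := h g (strictAnti_nat_of_succ_lt fun n => hf.reflect_lt (hg n))
    exact (hg N).ne (hN (N + 1) N.le_succ)
  refine ⟨hwf.min S hS, hwf.min_mem S hS, fun b hb => ?_⟩
  rcases le_total (hwf.min S hS) b with hab | hab
  · exact hf hab
  · exact ((hf hab).eq_of_not_lt (hwf.not_lt_min S hb)).ge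

/-! ### Images and kernels at a cut, and their behaviour under the structure maps. -/

section Cuts

variable {k : Type u} [Field k] {R : Type v} [LinearOrder R] {V : R ⥤ ModuleCat.{u} k}

/-- Replaces an intersection by one image, which is what lets a linear map be pushed through it.
Membership of t in `c.upper` makes the family non-empty. -/
theorem exists_imPlus_eq (hV : HasDCC V) (c : Cut R) {t : R} (ht : t ∈ c.upper) :
    ∃ s ∈ c.upper, ∃ h : s ≤ t, imPlus V c t = LinearMap.range (rho V h) := by
  obtain ⟨a, ha, hmin⟩ := exists_least_value (P := Set.Iic t)
    (f := fun s => LinearMap.range (rho V s.2)) (fun a b hab => range_rho_mono V hab b.2)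
    (fun s hs => hV.images t (fun n => s n) hs fun n => (s n).2)
    (S := {a | a.1 ∈ c.upper}) ⟨⟨t, le_rfl⟩, ht⟩
  refine ⟨a.1, ha, a.2, le_antisymm (iInf_le_of_le a.1 (iInf₂_le_of_le ha a.2 le_rfl)) ?_⟩
  exact le_iInf fun s => le_iInf₂ fun hs h => hmin ⟨s, h⟩ hs

theorem kerPlus_eq_top_or_exists (hV : HasDCC V) (c : Cut R) (t : R) :
    kerPlus V c t = ⊤ ∨
      ∃ r ∈ c.upper, ∃ h : t ≤ r, kerPlus V c t = LinearMap.ker (rho V h) := by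
  by_cases hne : ∃ r ∈ c.upper, t ≤ r
  · obtain ⟨r, hr, htr⟩ := hne
    obtain ⟨a, ha, hmin⟩ := exists_least_value (P := Set.Ici t)
      (f := fun s => LinearMap.ker (rho V s.2)) (fun a b hab => ker_rho_mono V a.2 hab)
      (fun s hs => hV.kernels t (fun n => s n) hs fun n => (s n).2)
      (S := {a | a.1 ∈ c.upper}) ⟨⟨r, htr⟩, hr⟩
    refine Or.inr ⟨a.1, ha, a.2, le_antisymm (iInf_le_of_le a.1 (iInf₂_le_of_le ha a.2 le_rfl)) ?_⟩
    exact le_iInf fun s => le_iInf₂ fun hs h => hmin ⟨s, h⟩ hs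
  · left
    push Not at hne
    exact eq_top_iff.2 (le_iInf fun s => le_iInf₂ fun hs h => absurd h (hne s hs).not_ge)

theorem mem_imPlus {c : Cut R} {t : R} {x : V.obj t} :
    x ∈ imPlus V c t ↔ ∀ s ∈ c.upper, ∀ h : s ≤ t, x ∈ LinearMap.range (rho V h) := by
  simp only [imPlus, Submodule.mem_iInf]

theorem mem_kerPlus {c : Cut R} {t : R} {x : V.obj t} :
    x ∈ kerPlus V c t ↔ ∀ r ∈ c.upper, ∀ h : t ≤ r, rho V h x = 0 := by
  simp only [kerPlus, Submodule.mem_iInf, LinearMap.mem_ker]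

theorem imMinus_le_imPlus (c : Cut R) (t : R) : imMinus V c t ≤ imPlus V c t :=
  iSup_le fun r => iSup₂_le fun hr _ => le_iInf fun s => le_iInf₂ fun hs hst =>
    range_rho_mono V (c.lt_of_mem r hr s hs).le hst

theorem kerMinus_le_kerPlus (c : Cut R) (t : R) : kerMinus V c t ≤ kerPlus V c t :=
  iSup_le fun r => iSup₂_le fun hr htr => le_iInf fun s => le_iInf₂ fun hs _ =>
    ker_rho_mono V htr (c.lt_of_mem r hr s hs).le

theorem mem_kerMinus {c : Cut R} {t : R} (ht : t ∈ c.lower) {x : V.obj t} :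
    x ∈ kerMinus V c t ↔ ∃ r ∈ c.lower, ∃ h : t ≤ r, rho V h x = 0 := by
  have h1 : kerMinus V c t =
      ⨆ r : {r : R // r ∈ c.lower ∧ t ≤ r}, LinearMap.ker (rho V r.2.2) := by
    simp only [kerMinus, iSup_subtype, iSup_and]
  have : Nonempty {r : R // r ∈ c.lower ∧ t ≤ r} := ⟨⟨t, ht, le_rfl⟩⟩
  rw [h1, Submodule.mem_iSup_of_directed]
  · simp only [LinearMap.mem_ker, Subtype.exists]
    exact ⟨fun ⟨r, hr, h0⟩ => ⟨r, hr.1, hr.2, h0⟩, fun ⟨r, hr, h, h0⟩ => ⟨r, ⟨hr, h⟩, h0⟩⟩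
  · refine directed_of_isDirected_le fun a b hab => ?_
    exact ker_rho_mono V a.2.2 hab

/-- Taking images does not commute with intersections in general; the inclusion from right to left
holds because Im⁺ at s is a single image. -/
theorem map_imPlus (hV : HasDCC V) {c : Cut R} {s t : R} (hs : s ∈ c.upper) (h : s ≤ t) :
    (imPlus V c s).map (rho V h) = imPlus V c t := by
  apply le_antisymm
  · rw [Submodule.map_le_iff_le_comap]
    refine fun x hx => Submodule.mem_comap.2 ?_
    refine mem_imPlus.2 fun r hr hrt => ?_
    rcases le_total r s with hrs | hsr
    · obtain ⟨y, rfl⟩ := mem_imPlus.1 hx r hr hrs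
      exact ⟨y, (rho_rho V hrs h y).symm⟩
    · exact ⟨rho V hsr x, rho_rho V hsr hrt x⟩
  · obtain ⟨r, hr, hrs, h1⟩ := exists_imPlus_eq hV c hs
    rw [h1, ← LinearMap.range_comp, rho_comp]
    exact iInf_le_of_le r (iInf₂_le_of_le hr (hrs.trans h) le_rfl)

theorem map_imMinus {c : Cut R} {s t : R} (hs : s ∈ c.upper) (h : s ≤ t) :
    (imMinus V c s).map (rho V h) = imMinus V c t := by
  simp only [imMinus, Submodule.map_iSup, ← LinearMap.range_comp, rho_comp]
  refine iSup_congr fun r => iSup_congr fun hr => ?_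
  have hrs := (c.lt_of_mem r hr s hs).le
  rw [iSup_pos hrs, iSup_pos (hrs.trans h)]

theorem comap_kerPlus {c : Cut R} {s t : R} (ht : t ∈ c.lower) (h : s ≤ t) :
    (kerPlus V c t).comap (rho V h) = kerPlus V c s := by
  simp only [kerPlus, Submodule.comap_iInf, ← LinearMap.ker_comp, rho_comp]
  refine iInf_congr fun r => iInf_congr fun hr => ?_
  have htr := (c.lt_of_mem t ht r hr).le
  rw [iInf_pos htr, iInf_pos (h.trans htr)]

theorem comap_kerMinus {c : Cut R} {s t : R} (hs : s ∈ c.lower) (ht : t ∈ c.lower) (h : s ≤ t) :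
    (kerMinus V c t).comap (rho V h) = kerMinus V c s := by
  ext x
  rw [Submodule.mem_comap, mem_kerMinus ht, mem_kerMinus hs]
  constructor
  · rintro ⟨r, hr, htr, h0⟩
    exact ⟨r, hr, h.trans htr, by rw [← h0, rho_rho]⟩
  · rintro ⟨r, hr, hsr, h0⟩
    rcases le_total t r with htr | hrt
    · exact ⟨r, hr, htr, by rw [rho_rho, h0]⟩
    · exact ⟨t, ht, le_rfl, by rw [rho_refl, ← rho_rho V hsr hrt, h0, map_zero]⟩

end Cuts

/-- Image filtrations push forward and kernel filtrations pull back; this identity lets the two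
kinds be intersected. -/
theorem map_inf_eq_of_map_eq_of_comap_eq {k E F : Type*} [Ring k] [AddCommGroup E] [Module k E]
    [AddCommGroup F] [Module k F] {f : E →ₗ[k] F} {A B : Submodule k E} {A' B' : Submodule k F}
    (hA : A.map f = A') (hB : B'.comap f = B) : (A ⊓ B).map f = A' ⊓ B' := by
  subst hA hB
  apply le_antisymm
  · rintro _ ⟨x, hx, rfl⟩
    exact ⟨⟨x, hx.1, rfl⟩, hx.2⟩
  · rintro _ ⟨⟨x, hx, rfl⟩, hx'⟩
    exact ⟨x, ⟨hx, hx'⟩, rfl⟩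

/-! ### Transition maps on V^±_{It}, and lifting to the inverse limit. -/

section Intervals

variable {k : Type u} [Field k] {R : Type v} [LinearOrder R] {V : R ⥤ ModuleCat.{u} k}
  {I : IntervalSet R} {s t : R}

theorem IntervalSet.mem_lowerCut_upper (ht : t ∈ I.carrier) : t ∈ I.lowerCut.upper :=
  ⟨t, ht, le_rfl⟩

theorem IntervalSet.mem_upperCut_lower (ht : t ∈ I.carrier) : t ∈ I.upperCut.lower :=
  ⟨t, ht, le_rfl⟩

@[ext]
theorem IntervalSet.ext {I J : IntervalSet R} (h : I.carrier = J.carrier) : I = J := by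
  cases I; cases J; congr

theorem pointMinus_le_pointPlus (I : IntervalSet R) (t : R) :
    pointMinus V I t ≤ pointPlus V I t :=
  sup_le (inf_le_inf_right _ (imMinus_le_imPlus _ _)) (inf_le_inf_left _ (kerMinus_le_kerPlus _ _))

theorem map_pointPlus (hV : HasDCC V) (hs : s ∈ I.carrier) (ht : t ∈ I.carrier) (h : s ≤ t) :
    (pointPlus V I s).map (rho V h) = pointPlus V I t :=
  map_inf_eq_of_map_eq_of_comap_eq (map_imPlus hV (I.mem_lowerCut_upper hs) h)
    (comap_kerPlus (I.mem_upperCut_lower ht) h)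

theorem map_pointMinus (hV : HasDCC V) (hs : s ∈ I.carrier) (ht : t ∈ I.carrier) (h : s ≤ t) :
    (pointMinus V I s).map (rho V h) = pointMinus V I t := by
  rw [pointMinus, Submodule.map_sup,
    map_inf_eq_of_map_eq_of_comap_eq (map_imMinus (I.mem_lowerCut_upper hs) h)
      (comap_kerPlus (I.mem_upperCut_lower ht) h),
    map_inf_eq_of_map_eq_of_comap_eq (map_imPlus hV (I.mem_lowerCut_upper hs) h)
      (comap_kerMinus (I.mem_upperCut_lower hs) (I.mem_upperCut_lower ht) h), pointMinus]

/-- Injectivity of the transition maps on V⁺/V⁻: after subtracting a lift in V⁻, the vector is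
killed at t ∈ I, so it lies in Im⁺ ∩ Ker⁻. -/
theorem mem_pointMinus_of_rho_mem (hV : HasDCC V) (hs : s ∈ I.carrier) (ht : t ∈ I.carrier)
    (h : s ≤ t) {x : V.obj s} (hx : x ∈ pointPlus V I s) (hx' : rho V h x ∈ pointMinus V I t) :
    x ∈ pointMinus V I s := by
  rw [← map_pointMinus hV hs ht h] at hx'
  obtain ⟨y, hy, hxy⟩ := hx'
  have hz : x - y ∈ pointMinus V I s := by
    refine Submodule.mem_sup_right ⟨?_, ?_⟩
    · exact (sub_mem hx (pointMinus_le_pointPlus I s hy)).1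
    · exact (mem_kerMinus (I.mem_upperCut_lower hs)).2
        ⟨t, I.mem_upperCut_lower ht, h, by rw [map_sub, hxy, sub_self]⟩
  simpa using add_mem hz hy

theorem mem_limMinus_of_apply_mem (hV : HasDCC V) {x : ∀ t : I.carrier, V.obj t.1}
    (hx : x ∈ limPlus V I) (t : I.carrier) (ht : x t ∈ pointMinus V I t) : x ∈ limMinus V I := by
  refine ⟨fun s => ?_, hx.2⟩
  rcases le_total s.1 t.1 with h | h
  · exact mem_pointMinus_of_rho_mem hV s.2 t.2 h (hx.1 s) (by rwa [hx.2 s t h])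
  · rw [← map_pointMinus hV t.2 s.2 h]
    exact ⟨x t, ht, hx.2 t s h⟩

/-- A modular-law argument: an Im⁻ summand that differs from a vector of V⁺ by one of V⁻ is itself
in Ker⁺. So enlarging V^± by Im⁻ to form sections does not change the quotient. -/
theorem pointPlus_inf_imMinus_sup_pointMinus_le (I : IntervalSet R) (t : R) :
    pointPlus V I t ⊓ (imMinus V I.lowerCut t ⊔ pointMinus V I t) ≤ pointMinus V I t := by
  rintro x ⟨hx, hx'⟩
  obtain ⟨a, ha, b, hb, rfl⟩ := Submodule.mem_sup.1 hx'
  have h1 := sub_mem hx (pointMinus_le_pointPlus I t hb)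
  rw [add_sub_cancel_right] at h1
  exact add_mem (Submodule.mem_sup_left ⟨ha, h1.2⟩) hb

/-- If I has no least element, any r in I has z < y < r in I; the open interval from z to r is
non-empty, so it meets the dense sequence. -/
theorem exists_coinitial_seq [TopologicalSpace R] [OrderTopology R]
    [TopologicalSpace.SeparableSpace R] (I : IntervalSet R) :
    ∃ f : ℕ → R, (∀ n, f n ∈ I.carrier) ∧ ∀ r ∈ I.carrier, ∃ n, f n ≤ r := by
  classical
  obtain ⟨t, ht⟩ := I.nonempty
  by_cases hm : ∃ m ∈ I.carrier, ∀ r ∈ I.carrier, m ≤ r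
  · obtain ⟨m, hm, hm'⟩ := hm
    exact ⟨fun _ => m, fun _ => hm, fun r hr => ⟨0, hm' r hr⟩⟩
  · push Not at hm
    have : Nonempty R := ⟨t⟩
    let d := TopologicalSpace.denseSeq R
    refine ⟨fun n => if d n ∈ I.carrier then d n else t, fun n => ?_, fun r hr => ?_⟩
    · dsimp only
      split_ifs with h
      exacts [h, ht]
    · obtain ⟨y, hy, hyr⟩ := hm r hr
      obtain ⟨z, hz, hzy⟩ := hm y hy
      obtain ⟨n, hn⟩ := (TopologicalSpace.denseRange_denseSeq R).exists_mem_open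
        (isOpen_Ioo (a := z) (b := r)) ⟨y, hzy, hyr⟩
      refine ⟨n, ?_⟩
      have : d n ∈ I.carrier := I.ordConnected.out hz hr ⟨hn.1.le, hn.2.le⟩
      simpa [this] using hn.2.le

theorem exists_antitone_coinitial_seq [TopologicalSpace R] [OrderTopology R]
    [TopologicalSpace.SeparableSpace R] (ht : t ∈ I.carrier) :
    ∃ f : ℕ → R, Antitone f ∧ f 0 = t ∧ (∀ n, f n ∈ I.carrier) ∧
      ∀ r ∈ I.carrier, ∃ n, f n ≤ r := by
  obtain ⟨g, hg, hg'⟩ := exists_coinitial_seq I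
  -- Running minima of `g`, started at t.
  let f : ℕ → R := fun n => Nat.rec t (fun n x => min x (g n)) n
  have hf : ∀ n, f (n + 1) = min (f n) (g n) := fun n => rfl
  refine ⟨f, antitone_nat_of_succ_le fun n => by rw [hf]; exact min_le_left _ _, rfl,
    fun n => ?_, fun r hr => ?_⟩
  · induction n with
    | zero => exact ht
    | succ n ih =>
      rw [hf]
      rcases min_choice (f n) (g n) with h | h <;> rw [h]
      exacts [ih, hg n]
  · obtain ⟨n, hn⟩ := hg' r hr
    exact ⟨n + 1, by rw [hf]; exact (min_le_right _ _).trans hn⟩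

/-- The Mittag-Leffler argument: lift x step by step along a decreasing coinitial sequence, using
surjectivity on V⁺, then push forward to the other points of I. -/
theorem exists_limPlus_apply_eq [TopologicalSpace R] [OrderTopology R]
    [TopologicalSpace.SeparableSpace R] (hV : HasDCC V) (ht : t ∈ I.carrier) {x : V.obj t}
    (hx : x ∈ pointPlus V I t) : ∃ y ∈ limPlus V I, y ⟨t, ht⟩ = x := by
  obtain ⟨f, hf, rfl, hfI, hcoin⟩ := exists_antitone_coinitial_seq ht
  have hsurj : ∀ n (y : pointPlus V I (f n)), ∃ z : pointPlus V I (f (n + 1)),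
      rho V (hf n.le_succ) z.1 = y.1 := fun n y => by
    obtain ⟨z, hz, hzy⟩ :=
      (map_pointPlus hV (hfI (n + 1)) (hfI n) (hf n.le_succ)).ge y.2
    exact ⟨⟨z, hz⟩, hzy⟩
  choose g hg using hsurj
  let y : ∀ n, pointPlus V I (f n) := fun n => Nat.rec ⟨x, hx⟩ (fun n z => g n z) n
  have hy : ∀ m n (h : m ≤ n), rho V (hf h) (y n).1 = (y m).1 := by
    intro m n h
    induction n, h using Nat.le_induction with
    | base => rw [rho_refl]
    | succ n h ih => rw [← ih, ← hg n (y n), rho_rho]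
  -- The value at r does not depend on which term of the sequence below r it is pushed from.
  have hcompat : ∀ (r : R) (m n : ℕ) (hm : f m ≤ r) (hn : f n ≤ r),
      rho V hm (y m).1 = rho V hn (y n).1 := by
    intro r m n hm hn
    rcases le_total m n with h | h
    · rw [← hy m n h, rho_rho]
    · rw [← hy n m h, rho_rho]
  choose N hN using fun r : I.carrier => hcoin r.1 r.2
  refine ⟨fun r => rho V (hN r) (y (N r)).1, ⟨fun r => ?_, fun r s h => ?_⟩, ?_⟩
  · rw [← map_pointPlus hV (hfI (N r)) r.2 (hN r)]
    exact ⟨_, (y (N r)).2, rfl⟩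
  · rw [rho_rho]
    exact hcompat _ _ _ _ _
  · have h0 := hcompat (f 0) (N ⟨f 0, ht⟩) 0 (hN _) le_rfl
    rw [rho_refl] at h0
    exact h0

end Intervals

/-! ### Linear independence from disjoint sections. -/

section Sections

variable {k U : Type*} [Field k] [AddCommGroup U] [Module k U]

theorem exists_max_section {κ : Type*} {F G : κ → Submodule k U} (hFG : ∀ a, F a ≤ G a)
    (hdisj : ∀ a b, a ≠ b → G a ≤ F b ∨ G b ≤ F a) (S : Finset κ) (hS : S.Nonempty) :
    ∃ a ∈ S, ∀ b ∈ S, b ≠ a → G b ≤ F a := by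
  classical
  induction hS using Finset.Nonempty.cons_induction with
  | singleton a => exact ⟨a, by simp, by simp⟩
  | cons a S ha hS ih =>
    obtain ⟨c, hc, hmax⟩ := ih
    have hac : a ≠ c := fun h => ha (h ▸ hc)
    rcases hdisj a c hac with h | h
    · refine ⟨c, by simp [hc], fun b hb hbc => ?_⟩
      rcases Finset.mem_cons.1 hb with rfl | hb
      exacts [h, hmax b hb hbc]
    · refine ⟨a, by simp, fun b hb hba => ?_⟩
      have hb := (Finset.mem_cons.1 hb).resolve_left hba
      by_cases hbc : b = c
      · exact hbc ▸ h
      · exact (hmax b hb hbc).trans ((hFG c).trans h)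

/-- Vectors chosen from the upper members of a disjoint family of sections `F a ≤ G a`, linearly
independent modulo `F a` for each `a`, are linearly independent. -/
theorem linearIndependent_of_sections {κ : Type*} {σ : κ → Type*} {F G : κ → Submodule k U}
    (hFG : ∀ a, F a ≤ G a) (hdisj : ∀ a b, a ≠ b → G a ≤ F b ∨ G b ≤ F a)
    (e : ∀ a, σ a → U) (he : ∀ a i, e a i ∈ G a)
    (hli : ∀ a, LinearIndependent k fun i => (F a).mkQ (e a i)) :
    LinearIndependent k fun p : Σ a, σ a => e p.1 p.2 := by
  classical
  rw [linearIndependent_iff']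
  intro s g hg p hp
  by_contra hgp
  -- Without the zero coefficients, the top section of the relation carries a non-zero one; modulo
  -- its lower member only its own terms survive.
  let s' := s.filter fun p => g p ≠ 0
  have hs' : ∑ p ∈ s', g p • e p.1 p.2 = 0 := by
    rw [← hg]
    refine Finset.sum_subset (Finset.filter_subset _ _) fun q hq hq' => ?_
    have : g q = 0 := by simpa [s', hq] using hq'
    rw [this, zero_smul]
  have hps' : p ∈ s' := Finset.mem_filter.2 ⟨hp, hgp⟩
  obtain ⟨a, ha, hmax⟩ := exists_max_section hFG hdisj (s'.image Sigma.fst)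
    ⟨p.1, Finset.mem_image_of_mem _ hps'⟩
  obtain ⟨q, hq, rfl⟩ := Finset.mem_image.1 ha
  have h1 : ∑ i ∈ s'.preimage (Sigma.mk q.1) sigma_mk_injective.injOn,
      g ⟨q.1, i⟩ • (F q.1).mkQ (e q.1 i) = 0 := by
    rw [Finset.sum_preimage (Sigma.mk q.1) s' sigma_mk_injective.injOn
      fun x => g x • (F q.1).mkQ (e x.1 x.2)]
    · simp only [← map_smul, ← map_sum, hs', map_zero]
    · rintro ⟨b, i⟩ hb hbi
      have hbq : b ≠ q.1 := by
        rintro rfl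
        exact hbi ⟨i, rfl⟩
      have := hmax b (Finset.mem_image_of_mem Sigma.fst hb) hbq (he b i)
      rw [Submodule.mkQ_apply, (Submodule.Quotient.mk_eq_zero _).2 this, smul_zero]
  have h2 := linearIndependent_iff'.1 (hli q.1) _ _ h1 q.2 (by simpa using hq)
  exact (Finset.mem_filter.1 hq).2 h2

end Sections

/-! ### Direct sums of interval modules as pointwise bases. -/

section Criterion

variable {k : Type u} [Field k] {R : Type v} [LinearOrder R]

/-- The vector `1` of the interval module at a point of the interval. -/
def intervalOne (k : Type u) [Field k] {I : IntervalSet R} {t : R} (ht : t ∈ I.carrier) :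
    (intervalModule k I).obj t :=
  (⟨1, mem_intervalFibre ht 1⟩ : intervalFibre k I t)

theorem eq_smul_intervalOne {I : IntervalSet R} {t : R} (ht : t ∈ I.carrier)
    (x : intervalFibre k I t) : x = x.1 • (intervalOne k ht : intervalFibre k I t) :=
  Subtype.ext (mul_one x.1).symm

theorem intervalFibre_eq_zero {I : IntervalSet R} {t : R} (ht : t ∉ I.carrier)
    (x : intervalFibre k I t) : x = 0 :=
  Subtype.ext (eq_zero_of_mem_intervalFibre ht x.2)

theorem rho_intervalOne {I : IntervalSet R} {s t : R} (hs : s ∈ I.carrier) (ht : t ∈ I.carrier)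
    (h : s ≤ t) : rho (intervalModule k I) h (intervalOne k hs) = intervalOne k ht := by
  have h1 : intervalMap k I s t ⟨1, mem_intervalFibre hs 1⟩ = ⟨1, mem_intervalFibre ht 1⟩ := by
    ext
    simp [intervalMap, ht]
  exact h1

theorem rho_intervalOne_of_notMem {I : IntervalSet R} {s t : R} (hs : s ∈ I.carrier)
    (ht : t ∉ I.carrier) (h : s ≤ t) :
    rho (intervalModule k I) h (intervalOne k hs) = 0 :=
  intervalFibre_eq_zero ht _

variable {Λ : Type w} (J : Λ → IntervalSet R)

open Classical in
/-- At the point `t`, a direct sum of interval modules has a basis indexed by the intervals that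
contain `t`. -/
noncomputable def directSumFibreEquiv (k : Type u) [Field k] (t : R) :
    DirectSum Λ (fun i => intervalFibre k (J i) t) ≃ₗ[k]
      ({i // t ∈ (J i).carrier} →₀ k) :=
  LinearEquiv.ofLinearMap
    (DirectSum.toModule k Λ _ fun i =>
      if h : t ∈ (J i).carrier then Finsupp.lsingle ⟨i, h⟩ ∘ₗ Submodule.subtype _ else 0)
    (Finsupp.linearCombination k fun i : {i // t ∈ (J i).carrier} =>
      DirectSum.lof k Λ (fun i => intervalFibre k (J i) t) i.1 ⟨1, mem_intervalFibre i.2 1⟩)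
    (by
      ext i : 2
      simp [i.2])
    (by
      ext i x : 2
      by_cases h : t ∈ (J i).carrier
      · simp only [LinearMap.comp_apply, DirectSum.toModule_lof, h, dif_pos, LinearMap.id_apply]
        simp only [Submodule.subtype_apply, Finsupp.lsingle_apply,
          Finsupp.linearCombination_single, ← map_smul]
        congr 1
        exact (eq_smul_intervalOne h x).symm
      · rw [intervalFibre_eq_zero h x]
        simp)

variable {J} {V : R ⥤ ModuleCat.{u} k}

open Classical in
theorem directSumFibreEquiv_symm_single {t : R} (i : {i // t ∈ (J i).carrier})
    (c : k) : (directSumFibreEquiv J k t).symm (Finsupp.single i c) =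
      c • DirectSum.lof k Λ (fun i => intervalFibre k (J i) t) i.1 ⟨1, mem_intervalFibre i.2 1⟩ :=
  Finsupp.linearCombination_single k c i

theorem isDirectSum_intervalModule_iff (ι : ∀ i, intervalModule k (J i) ⟶ V) :
    IsDirectSum (fun i => intervalModule k (J i)) V ι ↔
      ∀ t, LinearIndependent k
          (fun i : {i // t ∈ (J i).carrier} => ((ι i).app t).hom (intervalOne k i.2)) ∧
        Submodule.span k (Set.range
          fun i : {i // t ∈ (J i).carrier} => ((ι i).app t).hom (intervalOne k i.2)) = ⊤ := by
  classical
  refine forall_congr' fun t => ?_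
  have key : Finsupp.linearCombination k
      (fun i : {i // t ∈ (J i).carrier} => ((ι i).app t).hom (intervalOne k i.2)) =
      (DirectSum.toModule k Λ (V.obj t) (fun i => ((ι i).app t).hom) :
        DirectSum Λ (fun i => intervalFibre k (J i) t) →ₗ[k] V.obj t) ∘ₗ
        (directSumFibreEquiv J k t).symm.toLinearMap := by
    refine Finsupp.lhom_ext fun i c => ?_
    rw [Finsupp.linearCombination_single, LinearMap.comp_apply, LinearEquiv.coe_coe,
      directSumFibreEquiv_symm_single, map_smul]
    exact congrArg (c • ·) (DirectSum.toModule_lof k (ι := Λ)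
      (M := fun i => intervalFibre k (J i) t) (φ := fun i => ((ι i).app t).hom) i.1 _).symm
  rw [LinearIndependent, ← Finsupp.range_linearCombination, LinearMap.range_eq_top, key]
  have hb := (directSumFibreEquiv J k t).symm.bijective
  rw [← Function.Bijective, LinearMap.coe_comp]
  exact (hb.of_comp_iff _).symm

end Criterion

/-! ### Morphisms from interval modules, the covering property, and existence of the decomposition.
-/

section Limits

variable {k : Type u} [Field k] {R : Type v} [LinearOrder R] {V : R ⥤ ModuleCat.{u} k}

open Classical in
/-- The linear map from the fibre of `k_I` at `t` to `V_t` that sends `1` to `x_t`. -/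
noncomputable def fibreMap {I : IntervalSet R} (x : ∀ t : I.carrier, V.obj t.1) (t : R) :
    intervalFibre k I t →ₗ[k] V.obj t :=
  if h : t ∈ I.carrier then (LinearMap.toSpanSingleton k (V.obj t) (x ⟨t, h⟩)) ∘ₗ
    Submodule.subtype (intervalFibre k I t) else 0

theorem fibreMap_apply {I : IntervalSet R} (x : ∀ t : I.carrier, V.obj t.1) {t : R}
    (ht : t ∈ I.carrier) (a : intervalFibre k I t) : fibreMap x t a = a.1 • x ⟨t, ht⟩ := by
  simp [fibreMap, ht]

theorem rho_eq_zero_of_mem_limPlus {I : IntervalSet R} {x : ∀ t : I.carrier, V.obj t.1}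
    (hx : x ∈ limPlus V I) (s : I.carrier) {t : R} (ht : t ∉ I.carrier) (h : s.1 ≤ t) :
    rho V h (x s) = 0 :=
  mem_kerPlus.1 (hx.1 s).2 t (fun _ hr => lt_of_not_ge fun htr =>
    ht (I.ordConnected.out s.2 hr ⟨h, htr⟩)) h

/-- The morphism from `k_I` to `V` that sends `1` to the members of a family in `V⁺_I`. -/
noncomputable def limHom {I : IntervalSet R} {x : ∀ t : I.carrier, V.obj t.1}
    (hx : x ∈ limPlus V I) : intervalModule k I ⟶ V where
  app t := ModuleCat.ofHom (fibreMap x t)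
  naturality s t f := by
    refine ModuleCat.hom_ext (LinearMap.ext fun a => ?_)
    change intervalFibre k I s at a
    change fibreMap x t (intervalMap k I s t a) = rho V (leOfHom f) (fibreMap x s a)
    by_cases hs : s ∈ I.carrier
    · rw [fibreMap_apply x hs, map_smul]
      by_cases ht : t ∈ I.carrier
      · rw [fibreMap_apply x ht, hx.2 ⟨s, hs⟩ ⟨t, ht⟩ (leOfHom f)]
        simp [intervalMap, ht]
      · rw [rho_eq_zero_of_mem_limPlus hx ⟨s, hs⟩ ht,
          intervalFibre_eq_zero ht (intervalMap _ _ _ _ _), smul_zero, map_zero]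
    · rw [intervalFibre_eq_zero hs a, map_zero, map_zero, map_zero, map_zero]

theorem limHom_app_one {I : IntervalSet R} {x : ∀ t : I.carrier, V.obj t.1}
    (hx : x ∈ limPlus V I) {t : R} (ht : t ∈ I.carrier) :
    ((limHom hx).app t).hom (intervalOne k ht) = x ⟨t, ht⟩ :=
  (fibreMap_apply x ht _).trans (one_smul _ _)

/-- X locates both ends of I: the lower cut is where images in V_t stop being contained in X, the
upper cut is where kernels, intersected with that Im⁺, start to leave X. The chain condition makes
Im⁺ and Ker⁺ attained, so leaving X survives the intersections. -/
theorem exists_pointMinus_le_and_not_pointPlus_le (hV : HasDCC V) {t : R}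
    {X : Submodule k (V.obj t)} (hX : X ≠ ⊤) :
    ∃ I : IntervalSet R, t ∈ I.carrier ∧ pointMinus V I t ≤ X ∧ ¬ pointPlus V I t ≤ X := by
  let P : R → Prop := fun s => ∃ h : s ≤ t, LinearMap.range (rho V h) ≤ X
  have hPt : ¬ P t := fun ⟨h, hle⟩ => hX (eq_top_iff.2 fun x _ => hle ⟨x, rho_refl V h x⟩)
  have hPmono : ∀ r s, r ≤ s → P s → P r := fun r s hrs ⟨h, hle⟩ =>
    ⟨hrs.trans h, (range_rho_mono V hrs h).trans hle⟩
  let c : Cut R :=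
    { lower := {s | P s}
      upper := {s | ¬ P s}
      union_eq := Set.union_compl_self {s | P s}
      lt_of_mem := fun s hs r hr => lt_of_not_ge fun hrs => hr (hPmono r s hrs hs) }
  have hc : imMinus V c t ≤ X := iSup_le fun s => iSup₂_le fun hs h => hs.2
  have hc' : ¬ imPlus V c t ≤ X := by
    obtain ⟨s, hs, h, heq⟩ := exists_imPlus_eq hV c (t := t) hPt
    rw [heq]
    exact fun hle => hs ⟨h, hle⟩
  let Q : R → Prop := fun r => ∃ h : t ≤ r, ¬ imPlus V c t ⊓ LinearMap.ker (rho V h) ≤ X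
  have hQt : ¬ Q t := fun ⟨h, hle⟩ => hle fun x hx => by
    have : x = 0 := by rw [← rho_refl V h x]; exact hx.2
    rw [this]; exact X.zero_mem
  have hQmono : ∀ r s, r ≤ s → Q r → Q s := fun r s hrs ⟨h, hle⟩ =>
    ⟨h.trans hrs, fun h' => hle ((inf_le_inf_left _ (ker_rho_mono V h hrs)).trans h')⟩
  let d : Cut R :=
    { lower := {r | ¬ Q r}
      upper := {r | Q r}
      union_eq := Set.compl_union_self {s | Q s}
      lt_of_mem := fun s hs r hr => lt_of_not_ge fun hrs => hs (hQmono r s hrs hr) }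
  have hd : imPlus V c t ⊓ kerMinus V d t ≤ X := by
    rintro x ⟨hx, hx'⟩
    obtain ⟨r, hr, h, h0⟩ := (mem_kerMinus (c := d) hQt).1 hx'
    by_contra hxX
    exact hr ⟨h, fun hle => hxX (hle ⟨hx, h0⟩)⟩
  have hd' : ¬ imPlus V c t ⊓ kerPlus V d t ≤ X := by
    rcases kerPlus_eq_top_or_exists hV d t with h | ⟨r, hr, h, heq⟩
    · rwa [h, inf_top_eq]
    · rw [heq]
      exact hr.2
  let I : IntervalSet R :=
    { carrier := {s | ¬ P s ∧ ¬ Q s}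
      nonempty := ⟨t, hPt, hQt⟩
      ordConnected := ⟨fun r hr s hs x hx =>
        ⟨fun h => hr.1 (hPmono r x hx.1 h), fun h => hs.2 (hQmono x s hx.2 h)⟩⟩ }
  -- The two cuts of I are c and d, because t itself lies above c and below d.
  have hl1 : I.lowerCut.lower = c.lower := by
    ext r
    refine ⟨fun h => ?_, fun h s hs => c.lt_of_mem r h s hs.1⟩
    by_contra hr
    have hrt : r < t := h t ⟨hPt, hQt⟩
    exact lt_irrefl r (h r ⟨hr, fun hq => hQt (hQmono r t hrt.le hq)⟩)
  have hl2 : I.lowerCut.upper = c.upper := by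
    ext r
    refine ⟨fun ⟨s, hs, hsr⟩ hr => hs.1 (hPmono s r hsr hr), fun hr => ?_⟩
    by_contra h
    have : r ∈ c.lower := by
      rw [← hl1]
      exact ((Set.mem_union _ _ _).1 (I.lowerCut.union_eq ▸ Set.mem_univ r)).resolve_right h
    exact hr this
  have hu1 : I.upperCut.upper = d.upper := by
    ext r
    refine ⟨fun h => ?_, fun h s hs => d.lt_of_mem s hs.2 r h⟩
    by_contra hr
    have hrt : t < r := h t ⟨hPt, hQt⟩
    exact lt_irrefl r (h r ⟨fun hp => hPt (hPmono t r hrt.le hp), hr⟩)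
  have hu2 : I.upperCut.lower = d.lower := by
    ext r
    refine ⟨fun ⟨s, hs, hsr⟩ hr => hs.2 (hQmono r s hsr hr), fun hr => ?_⟩
    by_contra h
    have : r ∈ d.upper := by
      rw [← hu1]
      exact ((Set.mem_union _ _ _).1 (I.upperCut.union_eq ▸ Set.mem_univ r)).resolve_left h
    exact hr this
  have hlc : I.lowerCut = c := by
    rcases hc : I.lowerCut with ⟨a, b, _, _⟩
    rw [hc] at hl1 hl2
    dsimp only at hl1 hl2
    subst hl1 hl2
    rfl
  have huc : I.upperCut = d := by
    rcases hc : I.upperCut with ⟨a, b, _, _⟩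
    rw [hc] at hu1 hu2
    dsimp only at hu1 hu2
    subst hu1 hu2
    rfl
  refine ⟨I, ⟨hPt, hQt⟩, ?_, ?_⟩
  · rw [pointMinus, hlc, huc]
    exact sup_le (inf_le_left.trans hc) hd
  · rwa [pointPlus, hlc, huc]

/-- The upper member of the section of `V_t` determined by an interval. -/
def sectionPlus (V : R ⥤ ModuleCat.{u} k) (I : IntervalSet R) (t : R) : Submodule k (V.obj t) :=
  imMinus V I.lowerCut t ⊔ pointPlus V I t

/-- The lower member of the section of `V_t` determined by an interval. -/
def sectionMinus (V : R ⥤ ModuleCat.{u} k) (I : IntervalSet R) (t : R) : Submodule k (V.obj t) :=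
  imMinus V I.lowerCut t ⊔ pointMinus V I t

theorem pointMinus_le_sectionMinus (I : IntervalSet R) (t : R) :
    pointMinus V I t ≤ sectionMinus V I t :=
  le_sup_right

theorem imPlus_le_imMinus {c d : Cut R} {s t : R} (hc : s ∈ c.upper) (hd : s ∈ d.lower)
    (h : s ≤ t) : imPlus V c t ≤ imMinus V d t :=
  (iInf_le_of_le s (iInf₂_le_of_le hc h le_rfl)).trans
    (le_iSup_of_le s (le_iSup₂_of_le hd h le_rfl))

theorem kerPlus_le_kerMinus {c d : Cut R} {r t : R} (hc : r ∈ c.upper) (hd : r ∈ d.lower)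
    (h : t ≤ r) : kerPlus V c t ≤ kerMinus V d t :=
  (iInf_le_of_le r (iInf₂_le_of_le hc h le_rfl)).trans
    (le_iSup_of_le r (le_iSup₂_of_le hd h le_rfl))

theorem sectionPlus_le_imPlus (I : IntervalSet R) (t : R) :
    sectionPlus V I t ≤ imPlus V I.lowerCut t :=
  sup_le (imMinus_le_imPlus _ _) inf_le_left

/-- If some point of `I` below `t` lies to the left of `J`, the section of `I` is below that
of `J`. -/
theorem sectionPlus_le_of_left {I J : IntervalSet R} {s t : R} (hJ : t ∈ J.carrier)
    (hs : s ∈ I.carrier) (hs' : s ∉ J.carrier) (hst : s ≤ t) :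
    sectionPlus V I t ≤ sectionMinus V J t := by
  refine (sectionPlus_le_imPlus I t).trans (le_sup_of_le_left ?_)
  refine imPlus_le_imMinus (I.mem_lowerCut_upper hs) (fun r hr => lt_of_not_ge fun hrs => ?_) hst
  exact hs' (J.ordConnected.out hr hJ ⟨hrs, hst⟩)

/-- If `I` and `J` agree below `t` and some point of `J` above `t` lies to the right of `I`, the
section of `I` is below that of `J`. -/
theorem sectionPlus_le_of_right {I J : IntervalSet R} {r t : R} (hI : t ∈ I.carrier)
    (hJ : t ∈ J.carrier) (hIJ : ∀ s ≤ t, s ∈ I.carrier ↔ s ∈ J.carrier)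
    (hr : r ∈ J.carrier) (hr' : r ∉ I.carrier) (htr : t ≤ r) :
    sectionPlus V I t ≤ sectionMinus V J t := by
  have hl : ∀ s, s ∈ I.lowerCut.lower ↔ s ∈ J.lowerCut.lower := by
    have aux : ∀ (I J : IntervalSet R), t ∈ I.carrier → t ∈ J.carrier →
        (∀ s ≤ t, s ∈ I.carrier ↔ s ∈ J.carrier) →
        ∀ s, s ∈ I.lowerCut.lower → s ∈ J.lowerCut.lower := by
      intro I J hI hJ hIJ s hs q hq
      rcases le_total q t with h | h
      · exact hs q ((hIJ q h).2 hq)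
      · exact (hs t hI).trans_le h
    exact fun s => ⟨aux I J hI hJ hIJ s, aux J I hJ hI (fun s h => (hIJ s h).symm) s⟩
  have hu : ∀ s ≤ t, s ∈ J.lowerCut.upper → s ∈ I.lowerCut.upper := by
    rintro s hst ⟨q, hq, hqs⟩
    exact ⟨q, (hIJ q (hqs.trans hst)).2 hq, hqs⟩
  have h1 : imMinus V I.lowerCut t ≤ imMinus V J.lowerCut t :=
    iSup_le fun s => iSup₂_le fun hs h => le_iSup_of_le s (le_iSup₂_of_le ((hl s).1 hs) h le_rfl)
  have h2 : imPlus V I.lowerCut t ≤ imPlus V J.lowerCut t :=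
    le_iInf fun s => le_iInf₂ fun hs h => iInf_le_of_le s (iInf₂_le_of_le (hu s h hs) h le_rfl)
  have h3 : kerPlus V I.upperCut t ≤ kerMinus V J.upperCut t :=
    kerPlus_le_kerMinus (fun s hs => lt_of_not_ge fun hrs =>
      hr' (I.ordConnected.out hI hs ⟨htr, hrs⟩)) (J.mem_upperCut_lower hr) htr
  exact sup_le_sup h1 ((inf_le_inf h2 h3).trans le_sup_right)

/-- The order is lexicographic: a difference of the intervals below t decides first, and only if
there is none does a difference above t. -/
theorem sections_disjoint {I J : IntervalSet R} {t : R} (hI : t ∈ I.carrier)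
    (hJ : t ∈ J.carrier) (hne : I ≠ J) :
    sectionPlus V I t ≤ sectionMinus V J t ∨ sectionPlus V J t ≤ sectionMinus V I t := by
  by_cases hl : ∀ s ≤ t, s ∈ I.carrier ↔ s ∈ J.carrier
  · by_cases hr : ∀ s, t ≤ s → (s ∈ I.carrier ↔ s ∈ J.carrier)
    · exact absurd (IntervalSet.ext (Set.ext fun s => (le_total s t).elim (hl s) (hr s))) hne
    · push Not at hr
      obtain ⟨r, htr, ⟨h1, h2⟩ | ⟨h1, h2⟩⟩ := hr
      · exact Or.inr (sectionPlus_le_of_right hJ hI (fun s h => (hl s h).symm) h1 h2 htr)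
      · exact Or.inl (sectionPlus_le_of_right hI hJ hl h2 h1 htr)
  · push Not at hl
    obtain ⟨s, hst, ⟨h1, h2⟩ | ⟨h1, h2⟩⟩ := hl
    · exact Or.inl (sectionPlus_le_of_left hJ h1 h2 hst)
    · exact Or.inr (sectionPlus_le_of_left hI h2 h1 hst)

/-- Evaluation at `t` on `V⁺_I`. -/
def limEval (V : R ⥤ ModuleCat.{u} k) (I : IntervalSet R) (t : I.carrier) :
    limPlus V I →ₗ[k] V.obj t.1 :=
  LinearMap.proj t ∘ₗ (limPlus V I).subtype

theorem limMinus_le_comap_limEval {I : IntervalSet R} (t : I.carrier) :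
    (limMinus V I).submoduleOf (limPlus V I) ≤ (pointMinus V I t).comap (limEval V I t) :=
  fun _ hx => hx.1 t

/-- The map from `V⁺_I / V⁻_I` to a quotient of `V_t` induced by evaluation at `t`. -/
def limQuotientEval {I : IntervalSet R} (t : I.carrier) {X : Submodule k (V.obj t)}
    (hX : pointMinus V I t ≤ X) : limQuotient V I →ₗ[k] V.obj t ⧸ X :=
  Submodule.mapQ _ X (limEval V I t)
    ((limMinus_le_comap_limEval t).trans (Submodule.comap_mono hX))

theorem limQuotientEval_mk {I : IntervalSet R} (t : I.carrier) {X : Submodule k (V.obj t)}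
    (hX : pointMinus V I t ≤ X) (x : limPlus V I) :
    limQuotientEval t hX (Submodule.Quotient.mk x) = Submodule.Quotient.mk (x.1 t) := rfl

theorem apply_mem_of_limQuotientEval_eq_zero {I : IntervalSet R} {t : I.carrier}
    {X : Submodule k (V.obj t)} {hX : pointMinus V I t ≤ X} (h : limQuotientEval t hX = 0)
    {x : ∀ t : I.carrier, V.obj t.1} (hx : x ∈ limPlus V I) : x t ∈ X := by
  have h1 := limQuotientEval_mk t hX ⟨x, hx⟩
  rw [h, LinearMap.zero_apply] at h1
  exact (Submodule.Quotient.mk_eq_zero X).1 h1.symm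

theorem limQuotientEval_sectionMinus_injective (hV : HasDCC V) {I : IntervalSet R}
    (t : I.carrier) : Function.Injective
      (limQuotientEval t (pointMinus_le_sectionMinus (V := V) I t)) := by
  rw [← LinearMap.ker_eq_bot, LinearMap.ker_eq_bot']
  intro q hq
  obtain ⟨x, rfl⟩ := Submodule.Quotient.mk_surjective _ q
  rw [limQuotientEval_mk, Submodule.Quotient.mk_eq_zero] at hq
  rw [Submodule.Quotient.mk_eq_zero]
  exact mem_limMinus_of_apply_mem hV x.2 t
    (pointPlus_inf_imMinus_sup_pointMinus_le I t.1 ⟨x.2.1 t, hq⟩)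

variable [TopologicalSpace R] [OrderTopology R] [TopologicalSpace.SeparableSpace R]

theorem exists_isDirectSum_intervalModule (hV : HasDCC V) :
    ∃ (Λ : Type (max u v)) (J : Λ → IntervalSet R) (ι : ∀ i, intervalModule k (J i) ⟶ V),
      IsDirectSum (fun i => intervalModule k (J i)) V ι := by
  let B := fun I : IntervalSet R => Module.Basis.ofVectorSpace k (limQuotient V I)
  choose x hx using fun (I : IntervalSet R) i => Submodule.Quotient.mk_surjective _ (B I i)
  refine ⟨Σ I : IntervalSet R, Module.Basis.ofVectorSpaceIndex k (limQuotient V I), fun p => p.1,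
    fun p => limHom (x p.1 p.2).2, ?_⟩
  rw [isDirectSum_intervalModule_iff]
  intro t
  simp only [limHom_app_one]
  constructor
  · have hli := linearIndependent_of_sections (κ := {I : IntervalSet R // t ∈ I.carrier})
      (σ := fun I => Module.Basis.ofVectorSpaceIndex k (limQuotient V I.1))
      (F := fun I => sectionMinus V I.1 t) (G := fun I => sectionPlus V I.1 t)
      (fun I => sup_le_sup_left (pointMinus_le_pointPlus _ _) _)
      (fun I J hne => sections_disjoint I.2 J.2 fun h => hne (Subtype.ext h))
      (fun I i => (x I.1 i).1 ⟨t, I.2⟩)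
      (fun I i => Submodule.mem_sup_right ((x I.1 i).2.1 ⟨t, I.2⟩))
      (fun I => by
        have h1 := (B I.1).linearIndependent.map' _ (LinearMap.ker_eq_bot.2
          (limQuotientEval_sectionMinus_injective hV ⟨t, I.2⟩))
        have h2 : (limQuotientEval ⟨t, I.2⟩ (pointMinus_le_sectionMinus (V := V) I.1 t)) ∘
            B I.1 = fun i => (sectionMinus V I.1 t).mkQ ((x I.1 i).1 ⟨t, I.2⟩) :=
          funext fun i => by rw [Function.comp_apply, ← hx I.1 i]; rfl
        rw [← h2]
        exact h1)
    exact hli.comp (fun p : {p : Σ I : IntervalSet R,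
        Module.Basis.ofVectorSpaceIndex k (limQuotient V I) // t ∈ p.1.carrier} =>
        ⟨⟨p.1.1, p.2⟩, p.1.2⟩) fun p q h => by
      obtain ⟨⟨I, i⟩, hp⟩ := p
      obtain ⟨⟨J, j⟩, hq⟩ := q
      simp only [Sigma.mk.injEq, Subtype.mk.injEq] at h
      obtain ⟨rfl, h⟩ := h
      rw [heq_iff_eq] at h
      subst h
      rfl
  -- If the span X were proper, the covering interval would give a map V⁺_I/V⁻_I → V_t/X that
  -- vanishes on a basis. Since evaluation maps V⁺_I onto V⁺_{It}, this would force V⁺_{It} ≤ X.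
  · suffices key : ∀ X : Submodule k (V.obj t),
        (∀ I i (ht : t ∈ I.carrier), (x I i).1 ⟨t, ht⟩ ∈ X) → X = ⊤ from
      key _ fun I i ht => Submodule.subset_span ⟨⟨⟨I, i⟩, ht⟩, rfl⟩
    intro X hmem
    by_contra hX
    obtain ⟨I, ht, hle, hnot⟩ := exists_pointMinus_le_and_not_pointPlus_le hV hX
    have h0 : limQuotientEval (V := V) ⟨t, ht⟩ hle = 0 := by
      refine (B I).ext fun i => ?_
      rw [LinearMap.zero_apply, ← hx I i]
      exact (Submodule.Quotient.mk_eq_zero X).2 (hmem I i ht)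
    refine hnot fun y hy => ?_
    obtain ⟨z, hz, rfl⟩ := exists_limPlus_apply_eq hV ht hy
    exact apply_mem_of_limQuotientEval_eq_zero h0 hz

theorem rank_limQuotient (hV : HasDCC V) {I : IntervalSet R} {t : R} (ht : t ∈ I.carrier) :
    Cardinal.lift.{u} (Module.rank k (limQuotient V I)) =
      Cardinal.lift.{max u v} (Module.rank k
        (pointPlus V I t ⧸ (pointMinus V I t).submoduleOf (pointPlus V I t))) := by
  let f : limPlus V I →ₗ[k] pointPlus V I t :=
    (limEval V I ⟨t, ht⟩).codRestrict _ fun x => x.2.1 ⟨t, ht⟩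
  let g : limQuotient V I →ₗ[k] _ := Submodule.mapQ _
    ((pointMinus V I t).submoduleOf (pointPlus V I t)) f fun x hx => hx.1 ⟨t, ht⟩
  have hg : Function.Bijective g := by
    constructor
    · rw [← LinearMap.ker_eq_bot, LinearMap.ker_eq_bot']
      intro q hq
      obtain ⟨x, rfl⟩ := Submodule.Quotient.mk_surjective _ q
      change Submodule.Quotient.mk (f x) = 0 at hq
      rw [Submodule.Quotient.mk_eq_zero] at hq
      rw [Submodule.Quotient.mk_eq_zero]
      exact mem_limMinus_of_apply_mem hV x.2 ⟨t, ht⟩ hq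
    · intro q
      obtain ⟨y, rfl⟩ := Submodule.Quotient.mk_surjective _ q
      obtain ⟨z, hz, hzy⟩ := exists_limPlus_apply_eq hV ht y.2
      exact ⟨Submodule.Quotient.mk ⟨z, hz⟩, congrArg _ (Subtype.ext hzy)⟩
  exact (LinearEquiv.ofBijective g hg).lift_rank_eq

end Limits

/-! ### Counting summands in a decomposition into interval modules. -/

section Multiplicity

variable {k : Type u} [Field k] {R : Type v} [LinearOrder R] {V : R ⥤ ModuleCat.{u} k}
  {Λ : Type w} {J : Λ → IntervalSet R} {ι : ∀ i, intervalModule k (J i) ⟶ V}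
  (H : IsDirectSum (fun i => intervalModule k (J i)) V ι)

/-- The basis of `V_t` determined by a decomposition of `V` into interval modules. -/
noncomputable def fibreBasis (t : R) :
    Module.Basis {i // t ∈ (J i).carrier} k (V.obj t) :=
  Module.Basis.mk ((isDirectSum_intervalModule_iff ι).1 H t).1
    ((isDirectSum_intervalModule_iff ι).1 H t).2.ge

theorem fibreBasis_apply {t : R} (i : {i // t ∈ (J i).carrier}) :
    fibreBasis H t i = ((ι i).app t).hom (intervalOne k i.2) :=
  Module.Basis.mk_apply _ _ i

theorem rho_fibreBasis {s t : R} (h : s ≤ t) {i : Λ} (hs : s ∈ (J i).carrier)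
    (ht : t ∈ (J i).carrier) :
    rho V h (fibreBasis H s ⟨i, hs⟩) = fibreBasis H t ⟨i, ht⟩ := by
  rw [fibreBasis_apply, fibreBasis_apply, ← hom_rho, rho_intervalOne hs ht]

theorem rho_fibreBasis_of_notMem {s t : R} (h : s ≤ t) {i : Λ} (hs : s ∈ (J i).carrier)
    (ht : t ∉ (J i).carrier) : rho V h (fibreBasis H s ⟨i, hs⟩) = 0 := by
  rw [fibreBasis_apply, ← hom_rho, rho_intervalOne_of_notMem hs ht, map_zero]

theorem repr_rho {s t : R} (h : s ≤ t) {i : Λ} (hs : s ∈ (J i).carrier)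
    (ht : t ∈ (J i).carrier) (x : V.obj s) :
    (fibreBasis H t).repr (rho V h x) ⟨i, ht⟩ = (fibreBasis H s).repr x ⟨i, hs⟩ := by
  classical
  have : (fibreBasis H t).coord ⟨i, ht⟩ ∘ₗ rho V h = (fibreBasis H s).coord ⟨i, hs⟩ := by
    refine (fibreBasis H s).ext fun ⟨j, hj⟩ => ?_
    rw [LinearMap.comp_apply]
    by_cases hj' : t ∈ (J j).carrier
    · rw [rho_fibreBasis H h hj hj']
      simp [Finsupp.single_apply]
    · have hij : j ≠ i := fun e => hj' (e ▸ ht)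
      rw [rho_fibreBasis_of_notMem H h hj hj']
      simp [hij]
  exact LinearMap.congr_fun this x

theorem repr_rho_of_notMem {s t : R} (h : s ≤ t) {i : Λ} (hs : s ∉ (J i).carrier)
    (ht : t ∈ (J i).carrier) (x : V.obj s) :
    (fibreBasis H t).repr (rho V h x) ⟨i, ht⟩ = 0 := by
  classical
  have : (fibreBasis H t).coord ⟨i, ht⟩ ∘ₗ rho V h = 0 := by
    refine (fibreBasis H s).ext fun ⟨j, hj⟩ => ?_
    rw [LinearMap.comp_apply]
    have hij : j ≠ i := fun e => hs (e ▸ hj)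
    by_cases hj' : t ∈ (J j).carrier
    · rw [rho_fibreBasis H h hj hj']
      simp [hij]
    · rw [rho_fibreBasis_of_notMem H h hj hj']
      simp
  exact LinearMap.congr_fun this x

/-- The span of the basis vectors of `V_t` with index in a given set. -/
noncomputable def coordSpan (t : R) (S : Set Λ) : Submodule k (V.obj t) :=
  Submodule.span k (fibreBasis H t '' {i | i.1 ∈ S})

theorem mem_coordSpan {t : R} {S : Set Λ} {x : V.obj t} :
    x ∈ coordSpan H t S ↔ ∀ i, (fibreBasis H t).repr x i ≠ 0 → i.1 ∈ S := by
  rw [coordSpan, Module.Basis.mem_span_image]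
  simp only [Set.subset_def, Finset.mem_coe, Finsupp.mem_support_iff]
  rfl

theorem coordSpan_inter (t : R) (S S' : Set Λ) :
    coordSpan H t (S ∩ S') = coordSpan H t S ⊓ coordSpan H t S' := by
  ext x
  simp only [Submodule.mem_inf, mem_coordSpan, Set.mem_inter_iff]
  exact ⟨fun h => ⟨fun i hi => (h i hi).1, fun i hi => (h i hi).2⟩,
    fun h i hi => ⟨h.1 i hi, h.2 i hi⟩⟩

theorem coordSpan_union (t : R) (S S' : Set Λ) :
    coordSpan H t (S ∪ S') = coordSpan H t S ⊔ coordSpan H t S' := by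
  rw [coordSpan, coordSpan, coordSpan, ← Submodule.span_union, ← Set.image_union]
  rfl

/-- The index is a `Sort` so that the propositional bounds in the definitions of Im and Ker are
covered as well. -/
theorem coordSpan_iUnion {α : Sort*} (t : R) (S : α → Set Λ) :
    coordSpan H t (⋃ a, S a) = ⨆ a, coordSpan H t (S a) := by
  simp only [coordSpan]
  rw [← Submodule.span_iUnion, ← Set.image_iUnion]
  congr 2
  ext i
  simp

theorem coordSpan_iInter {α : Sort*} (t : R) (S : α → Set Λ) :
    coordSpan H t (⋂ a, S a) = ⨅ a, coordSpan H t (S a) := by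
  ext x
  simp only [Submodule.mem_iInf, mem_coordSpan, Set.mem_iInter]
  exact ⟨fun h a i hi => h i hi a, fun h i hi a => h a i hi⟩

theorem range_rho_eq_coordSpan {s t : R} (h : s ≤ t) :
    LinearMap.range (rho V h) = coordSpan H t {i | s ∈ (J i).carrier} := by
  ext x
  rw [mem_coordSpan]
  constructor
  · rintro ⟨y, rfl⟩ i hi
    by_contra hs
    exact hi (repr_rho_of_notMem H h hs i.2 y)
  · intro hx
    rw [← (fibreBasis H t).linearCombination_repr x, Finsupp.linearCombination_apply]
    refine Submodule.sum_mem _ fun i hi => Submodule.smul_mem _ _ ?_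
    exact ⟨_, rho_fibreBasis H h (hx i (Finsupp.mem_support_iff.1 hi)) i.2⟩

theorem ker_rho_eq_coordSpan {t r : R} (h : t ≤ r) :
    LinearMap.ker (rho V h) = coordSpan H t {i | r ∉ (J i).carrier} := by
  ext x
  rw [mem_coordSpan, LinearMap.mem_ker]
  constructor
  · intro hx i hi hr
    apply hi
    rw [← repr_rho H h i.2 hr, hx, map_zero, Finsupp.zero_apply]
  · intro hx
    refine (fibreBasis H r).ext_elem fun ⟨i, hi⟩ => ?_
    rw [map_zero, Finsupp.zero_apply]
    by_cases ht : t ∈ (J i).carrier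
    · rw [repr_rho H h ht hi]
      by_contra h0
      exact hx ⟨i, ht⟩ h0 hi
    · exact repr_rho_of_notMem H h ht hi x

/-- The indices of the summands `k_J` of `V` with `(k_J)⁺_{It} ≠ 0`. -/
def plusIndices (J : Λ → IntervalSet R) (I : IntervalSet R) (t : R) : Set Λ :=
  {i | (∀ s ∈ I.lowerCut.upper, s ≤ t → s ∈ (J i).carrier) ∧
    ∀ r ∈ I.upperCut.upper, t ≤ r → r ∉ (J i).carrier}

/-- The indices of the summands `k_J` of `V` with `(k_J)⁻_{It} ≠ 0`. -/
def minusIndices (J : Λ → IntervalSet R) (I : IntervalSet R) (t : R) : Set Λ :=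
  {i | ((∃ s ∈ I.lowerCut.lower, s ≤ t ∧ s ∈ (J i).carrier) ∧
      ∀ r ∈ I.upperCut.upper, t ≤ r → r ∉ (J i).carrier) ∨
    ((∀ s ∈ I.lowerCut.upper, s ≤ t → s ∈ (J i).carrier) ∧
      ∃ r ∈ I.upperCut.lower, t ≤ r ∧ r ∉ (J i).carrier)}

theorem pointPlus_eq_coordSpan (I : IntervalSet R) (t : R) :
    pointPlus V I t = coordSpan H t (plusIndices J I t) := by
  simp only [pointPlus, imPlus, kerPlus, range_rho_eq_coordSpan H, ker_rho_eq_coordSpan H,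
    ← coordSpan_iInter, ← coordSpan_inter]
  congr 1
  ext i
  simp [plusIndices]

theorem pointMinus_eq_coordSpan (I : IntervalSet R) (t : R) :
    pointMinus V I t = coordSpan H t (minusIndices J I t) := by
  simp only [pointMinus, imPlus, kerPlus, imMinus, kerMinus, range_rho_eq_coordSpan H,
    ker_rho_eq_coordSpan H, ← coordSpan_iInter, ← coordSpan_iUnion, ← coordSpan_inter,
    ← coordSpan_union]
  congr 1
  ext i
  simp [minusIndices, and_left_comm]

/-- The plus conditions put I below t inside J i and exclude what lies right of I; failing both
minus conditions then excludes what lies left of I and includes I above t. -/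
theorem mem_plusIndices_diff_iff {I : IntervalSet R} {t : R} (ht : t ∈ I.carrier) (i : Λ) :
    i ∈ plusIndices J I t \ minusIndices J I t ↔ J i = I := by
  constructor
  · rintro ⟨⟨h1, h2⟩, h3⟩
    have h4 : ∀ s ∈ I.lowerCut.lower, s ≤ t → s ∉ (J i).carrier :=
      fun s hs hst hs' => h3 (Or.inl ⟨⟨s, hs, hst, hs'⟩, h2⟩)
    have h5 : ∀ r ∈ I.upperCut.lower, t ≤ r → r ∈ (J i).carrier := fun r hr htr => by
      by_contra hr'
      exact h3 (Or.inr ⟨h1, ⟨r, hr, htr, hr'⟩⟩)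
    refine IntervalSet.ext (Set.ext fun s => ⟨fun hs => ?_, fun hs => ?_⟩)
    · by_contra hsI
      rcases le_total s t with hst | hts
      · exact h4 s (fun r hr => lt_of_not_ge fun hrs =>
          hsI (I.ordConnected.out hr ht ⟨hrs, hst⟩)) hst hs
      · exact h2 s (fun r hr => lt_of_not_ge fun hsr =>
          hsI (I.ordConnected.out ht hr ⟨hts, hsr⟩)) hts hs
    · rcases le_total s t with hst | hts
      · exact h1 s (I.mem_lowerCut_upper hs) hst
      · exact h5 s (I.mem_upperCut_lower hs) hts
  · rintro rfl
    have h2 : ∀ r ∈ (J i).upperCut.upper, t ≤ r → r ∉ (J i).carrier :=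
      fun r hr _ hr' => lt_irrefl r (hr r hr')
    refine ⟨⟨?_, h2⟩, ?_⟩
    · rintro s ⟨q, hq, hqs⟩ hst
      exact (J i).ordConnected.out hq ht ⟨hqs, hst⟩
    · rintro (⟨⟨s, hs, _, hs'⟩, _⟩ | ⟨_, r, ⟨q, hq, hrq⟩, htr, hr'⟩)
      · exact lt_irrefl s (hs s hs')
      · exact hr' ((J i).ordConnected.out ht hq ⟨htr, hrq⟩)

/-- Restricting coordinates to A \ B maps the span for A onto the finitely supported functions
there, with kernel the part spanned by B. -/
theorem rank_coordSpan_quotient (t : R) (A B : Set Λ) :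
    Cardinal.lift.{w} (Module.rank k
      (coordSpan H t A ⧸ (coordSpan H t B).submoduleOf (coordSpan H t A))) =
    Cardinal.lift.{u} (Cardinal.mk {i : Λ // t ∈ (J i).carrier ∧ i ∈ A \ B}) := by
  classical
  let D : Set {i // t ∈ (J i).carrier} := {i | i.1 ∈ A \ B}
  let f : coordSpan H t A →ₗ[k] (D →₀ k) :=
    Finsupp.lsubtypeDomain D ∘ₗ (fibreBasis H t).repr.toLinearMap ∘ₗ Submodule.subtype _
  have hf : ∀ x i, f x i = (fibreBasis H t).repr x.1 i.1 := fun x i => rfl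
  have hker : LinearMap.ker f = (coordSpan H t B).submoduleOf (coordSpan H t A) := by
    ext x
    rw [LinearMap.mem_ker, Submodule.submoduleOf, Submodule.mem_comap, Submodule.subtype_apply,
      mem_coordSpan]
    constructor
    · intro hx i hi
      by_contra hB
      exact hi (DFunLike.congr_fun hx ⟨i, (mem_coordSpan H).1 x.2 i hi, hB⟩)
    · intro hx
      ext i
      rw [hf]
      by_contra h0
      exact i.2.2 (hx _ h0)
  have hsurj : Function.Surjective f := by
    intro y
    refine ⟨⟨(fibreBasis H t).repr.symm (y.extendDomain), ?_⟩, ?_⟩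
    · rw [mem_coordSpan, LinearEquiv.apply_symm_apply]
      intro i hi
      by_contra hA
      have : i ∉ D := fun h => hA h.1
      exact hi (by simp [this])
    · ext i
      rw [hf, LinearEquiv.apply_symm_apply]
      simp
  have e := (Submodule.quotEquivOfEq _ _ hker.symm).trans (f.quotKerEquivOfSurjective hsurj)
  have h1 := e.lift_rank_eq
  rw [rank_finsupp_self] at h1
  have h2 : Cardinal.mk D = Cardinal.mk {i : Λ // t ∈ (J i).carrier ∧ i ∈ A \ B} :=
    Cardinal.mk_congr (Equiv.subtypeSubtypeEquivSubtypeInter _ (fun i => i ∈ A \ B))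
  rw [h2] at h1
  rw [← Cardinal.lift_umax.{u, w}, h1]
  exact Cardinal.lift_id'.{u, w} _

theorem mk_eq_rank_limQuotient [TopologicalSpace R] [OrderTopology R]
    [TopologicalSpace.SeparableSpace R] (hV : HasDCC V)
    (H : IsDirectSum (fun i => intervalModule k (J i)) V ι) (I : IntervalSet R) :
    Cardinal.lift.{max u v} (Cardinal.mk {i : Λ // J i = I}) =
      Cardinal.lift.{w} (Module.rank k (limQuotient V I)) := by
  obtain ⟨t, ht⟩ := I.nonempty
  have h1 := rank_limQuotient hV ht
  have h2 := rank_coordSpan_quotient H t (plusIndices J I t) (minusIndices J I t)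
  rw [← pointPlus_eq_coordSpan, ← pointMinus_eq_coordSpan] at h2
  have h3 : Cardinal.mk {i : Λ // t ∈ (J i).carrier ∧ i ∈ plusIndices J I t \ minusIndices J I t} =
      Cardinal.mk {i : Λ // J i = I} := by
    refine Cardinal.mk_congr (Equiv.subtypeEquivRight fun i => ?_)
    rw [mem_plusIndices_diff_iff ht]
    exact ⟨fun h => h.2, fun h => ⟨h ▸ ht, h⟩⟩
  rw [h3] at h2
  rw [Cardinal.lift_id'.{u, max u v}] at h1
  rw [h1, ← Cardinal.lift_lift.{u, v, w}, ← h2, Cardinal.lift_lift.{w, v, u},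
    Cardinal.lift_lift.{max u v, w, u}]
  exact (congrFun Cardinal.lift_umax.{u, max v w} _).symm

end Multiplicity

/-! ### Indecomposable summands and interval modules. -/

section Retracts

variable {k : Type u} [Field k] {R : Type v} [LinearOrder R] {V : R ⥤ ModuleCat.{u} k}

theorem IsDirectSum.exists_retraction {Λ : Type w} {M : Λ → (R ⥤ ModuleCat.{u} k)}
    {ι : ∀ i, M i ⟶ V} (H : IsDirectSum M V ι) (i : Λ) : ∃ π : V ⟶ M i, ι i ≫ π = 𝟙 _ := by
  classical
  let e : ∀ t, DirectSum Λ (fun i => ((M i).obj t : Type u)) ≃ₗ[k] V.obj t := fun t =>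
    LinearEquiv.ofBijective (DirectSum.toModule k Λ (V.obj t) fun i => ((ι i).app t).hom) (H t)
  have he : ∀ t j (x : (M j).obj t),
      e t (DirectSum.lof k Λ (fun i => ((M i).obj t : Type u)) j x) = ((ι j).app t).hom x :=
    fun t j x => DirectSum.toModule_lof k (φ := fun i => ((ι i).app t).hom) j x
  let p : ∀ t, V.obj t →ₗ[k] (M i).obj t := fun t =>
    DirectSum.component k Λ (fun i => ((M i).obj t : Type u)) i ∘ₗ (e t).symm.toLinearMap
  have hp : ∀ t (x : (M i).obj t), p t (((ι i).app t).hom x) = x := fun t x => by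
    simp only [p, LinearMap.comp_apply, LinearEquiv.coe_coe, ← he, LinearEquiv.symm_apply_apply]
    exact DirectSum.component.lof_self (M := fun i => ((M i).obj t : Type u)) k i x
  have hp' : ∀ t j (x : (M j).obj t), j ≠ i → p t (((ι j).app t).hom x) = 0 := fun t j x hj => by
    simp only [p, LinearMap.comp_apply, LinearEquiv.coe_coe, ← he, LinearEquiv.symm_apply_apply]
    rw [DirectSum.component.of, dif_neg hj]
  have hnat : ∀ s t (h : s ≤ t), (p t ∘ₗ rho V h) ∘ₗ (e s).toLinearMap =
      (rho (M i) h ∘ₗ p s) ∘ₗ (e s).toLinearMap := fun s t h => by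
    refine DirectSum.linearMap_ext k fun j => LinearMap.ext fun x => ?_
    simp only [LinearMap.comp_apply, LinearEquiv.coe_coe, he, ← hom_rho]
    by_cases hj : j = i
    · subst hj
      rw [hp, hp]
    · rw [hp' _ _ _ hj, hp' _ _ _ hj, map_zero]
  refine ⟨{ app := fun t => ModuleCat.ofHom (p t), naturality := fun s t f => ?_ }, ?_⟩
  · refine ModuleCat.hom_ext (LinearMap.ext fun x => ?_)
    have := LinearMap.congr_fun (hnat s t (leOfHom f)) ((e s).symm x)
    simp only [LinearMap.comp_apply, LinearEquiv.coe_coe, LinearEquiv.apply_symm_apply] at this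
    exact this
  · ext t x
    exact hp t x

/-- Images and kernels in a retract are the preimages under f of those in V, so stabilization is
inherited. -/
theorem HasDCC.of_retract (hV : HasDCC V) {M : R ⥤ ModuleCat.{u} k} {f : M ⟶ V} {g : V ⟶ M}
    (h : f ≫ g = 𝟙 M) : HasDCC M := by
  have hfg : ∀ t (x : M.obj t), (g.app t).hom ((f.app t).hom x) = x := fun t x => by
    have := congrArg (fun φ => (φ.app t).hom x) h
    exact this
  have hrange : ∀ {s t} (h : s ≤ t), LinearMap.range (rho M h) =
      (LinearMap.range (rho V h)).comap (f.app t).hom := fun {s t} h => by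
    ext x
    constructor
    · rintro ⟨y, rfl⟩
      exact ⟨(f.app s).hom y, (hom_rho f h y).symm⟩
    · rintro ⟨y, hy⟩
      exact ⟨(g.app s).hom y, by rw [← hom_rho, hy, hfg]⟩
  have hker : ∀ {t r} (h : t ≤ r), LinearMap.ker (rho M h) =
      (LinearMap.ker (rho V h)).comap (f.app t).hom := fun {t r} h => by
    ext x
    rw [Submodule.mem_comap, LinearMap.mem_ker, LinearMap.mem_ker, ← hom_rho]
    exact ⟨fun h0 => by rw [h0, map_zero], fun h0 => by rw [← hfg r (rho M h x), h0, map_zero]⟩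
  constructor
  · intro t s hs hst
    obtain ⟨N, hN⟩ := hV.images t s hs hst
    exact ⟨N, fun n hn => by rw [hrange, hrange, hN n hn]⟩
  · intro t s hs hst
    obtain ⟨N, hN⟩ := hV.kernels t s hs hst
    exact ⟨N, fun n hn => by rw [hker, hker, hN n hn]⟩

theorem not_isZero_intervalModule (I : IntervalSet R) :
    ¬ Limits.IsZero (intervalModule k I) := by
  intro h
  obtain ⟨t, ht⟩ := I.nonempty
  have h1 : (1 : k) = 0 := by
    have := congrArg (fun φ : intervalModule k I ⟶ intervalModule k I =>
      (φ.app t).hom (intervalOne k ht)) ((Limits.IsZero.iff_id_eq_zero _).1 h)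
    exact congrArg Subtype.val (show (intervalOne k ht : intervalFibre k I t) = 0 from this)
  exact one_ne_zero h1

/-- The split mono f exhibits X as Y ⊞ coker f, so the cokernel must vanish. -/
theorem isIso_of_indecomposable {C : Type*} [Category* C] [Abelian C] {X Y : C}
    (hX : Indecomposable X) (hY : ¬ Limits.IsZero Y) {f : Y ⟶ X} {g : X ⟶ Y}
    (h : f ≫ g = 𝟙 Y) : IsIso f := by
  have : IsSplitMono f := IsSplitMono.mk' ⟨g, h⟩
  have hb := Limits.isBilimitBinaryBiconeOfIsSplitMonoOfCokernel (Limits.cokernelIsCokernel f)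
  have hc := (hX.2 _ _ (Limits.biprod.uniqueUpToIso _ _ hb)).resolve_left hY
  have : Epi f := Abelian.epi_of_cokernel_π_eq_zero f (hc.eq_of_tgt _ _)
  exact isIso_of_mono_of_epi f

theorem isZero_of_isDirectSum_of_isEmpty {Λ : Type w} [IsEmpty Λ]
    {M : Λ → (R ⥤ ModuleCat.{u} k)} {ι : ∀ i, M i ⟶ V} (H : IsDirectSum M V ι) :
    Limits.IsZero V := by
  refine Functor.isZero V fun t => ?_
  have : Subsingleton (V.obj t) := (H t).2.subsingleton
  exact ModuleCat.isZero_of_subsingleton _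

theorem exists_iso_intervalModule [TopologicalSpace R] [OrderTopology R]
    [TopologicalSpace.SeparableSpace R] (hV : HasDCC V) (hind : Indecomposable V) :
    ∃ I : IntervalSet R, Nonempty (V ≅ intervalModule k I) := by
  obtain ⟨Λ, J, ι, H⟩ := exists_isDirectSum_intervalModule hV
  rcases isEmpty_or_nonempty Λ with hΛ | ⟨⟨i⟩⟩
  · exact absurd (isZero_of_isDirectSum_of_isEmpty H) hind.1
  · obtain ⟨π, hπ⟩ := H.exists_retraction i
    have := isIso_of_indecomposable hind (not_isZero_intervalModule (J i)) hπ
    exact ⟨J i, ⟨(asIso (ι i)).symm⟩⟩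

theorem eq_of_intervalModule_iso {I J : IntervalSet R}
    (e : intervalModule k I ≅ intervalModule k J) : I = J := by
  have aux : ∀ {I J : IntervalSet R} (_ : intervalModule k I ≅ intervalModule k J),
      I.carrier ⊆ J.carrier := fun {I J} e t ht => by
    by_contra ht'
    have h1 : (e.inv.app t).hom ((e.hom.app t).hom (intervalOne k ht)) = intervalOne k ht := by
      have := congrArg (fun φ => (φ.app t).hom (intervalOne k ht)) e.hom_inv_id
      exact this
    have h2 : (e.hom.app t).hom (intervalOne k ht) = 0 := intervalFibre_eq_zero ht' _
    rw [h2, map_zero] at h1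
    exact one_ne_zero (congrArg Subtype.val
      (show (0 : intervalFibre k I t) = ⟨1, mem_intervalFibre ht 1⟩ from h1)).symm
  exact IntervalSet.ext ((aux e).antisymm (aux e.symm))

theorem rho_intervalModule_val {I : IntervalSet R} {s t : R} (ht : t ∈ I.carrier) (h : s ≤ t)
    (x : intervalFibre k I s) :
    Subtype.val (p := (· ∈ intervalFibre k I t)) (rho (intervalModule k I) h x) = x.1 := by
  have : (intervalMap k I s t x).1 = x.1 := by simp [intervalMap, ht]
  exact this

/-- Naturality makes the scalar by which f acts the same at all points of I, since any two of them
are comparable. -/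
theorem intervalModule_endo_eq {I : IntervalSet R} (f : intervalModule k I ⟶ intervalModule k I) :
    ∃ c : k, f = c • 𝟙 (intervalModule k I) := by
  let a : ∀ t, t ∈ I.carrier → intervalFibre k I t := fun t ht => (f.app t).hom (intervalOne k ht)
  have ha : ∀ s t (hs : s ∈ I.carrier) (ht : t ∈ I.carrier), s ≤ t → (a s hs).1 = (a t ht).1 := by
    intro s t hs ht h
    have h1 : a t ht = rho (intervalModule k I) h (a s hs) := by
      rw [← hom_rho, rho_intervalOne hs ht]
    rw [h1]
    exact (rho_intervalModule_val ht h _).symm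
  obtain ⟨s, hs⟩ := I.nonempty
  refine ⟨(a s hs).1, ?_⟩
  ext t x
  change intervalFibre k I t at x
  by_cases ht : t ∈ I.carrier
  · have h1 : (a t ht).1 = (a s hs).1 :=
      (le_total s t).elim (fun h => (ha _ _ hs ht h).symm) (ha _ _ ht hs)
    have h2 : (f.app t).hom x = x.1 • a t ht := by
      conv_lhs => rw [eq_smul_intervalOne ht x]
      exact map_smul _ _ _
    refine h2.trans (Subtype.ext ?_)
    change x.1 * (a t ht).1 = (a s hs).1 * x.1
    rw [h1, mul_comm]
  · exact (intervalFibre_eq_zero ht _).trans (intervalFibre_eq_zero ht _).symm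

theorem indecomposable_intervalModule (I : IntervalSet R) :
    Indecomposable (intervalModule k I) := by
  refine ⟨not_isZero_intervalModule I, fun Y Z φ => ?_⟩
  -- The idempotent projecting onto Y is a scalar c with c² = c: c = 0 kills Y and c = 1 kills Z.
  let e := φ.hom ≫ Limits.biprod.fst ≫ Limits.biprod.inl ≫ φ.inv
  have he : e ≫ e = e := by simp [e]
  obtain ⟨c, hc⟩ := intervalModule_endo_eq e
  have hcc : c * c = c := by
    by_contra hne
    refine not_isZero_intervalModule (k := k) I ((Limits.IsZero.iff_id_eq_zero _).2 ?_)
    have h1 : (c * c - c) • 𝟙 (intervalModule k I) = 0 := by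
      rw [hc] at he
      simpa [sub_smul, sub_eq_zero, mul_smul] using he
    exact (smul_eq_zero_iff_right (sub_ne_zero.2 hne)).1 h1
  rcases eq_or_ne c 0 with rfl | h
  · left
    rw [zero_smul] at hc
    rw [Limits.IsZero.iff_id_eq_zero]
    have h1 : Limits.biprod.inl ≫ φ.inv ≫ e ≫ φ.hom ≫ Limits.biprod.fst = 𝟙 Y := by simp [e]
    rw [← h1, hc]
    simp
  · right
    have h0 := mul_left_cancel₀ h (hcc.trans (mul_one c).symm)
    rw [h0, one_smul] at hc
    rw [Limits.IsZero.iff_id_eq_zero]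
    have h1 : Limits.biprod.inr ≫ φ.inv ≫ e ≫ φ.hom ≫ Limits.biprod.snd = (0 : Z ⟶ Z) := by
      simp [e]
    rw [← h1, hc]
    simp

end Retracts

/-! ### Replacing summands by isomorphic ones. -/

section Isomorphisms

variable {k : Type u} [Field k] {R : Type v} [LinearOrder R] {V : R ⥤ ModuleCat.{u} k}

theorem IsDirectSum.of_iso {Λ : Type w} {M N : Λ → (R ⥤ ModuleCat.{u} k)} {ι : ∀ i, M i ⟶ V}
    (H : IsDirectSum M V ι) (α : ∀ i, N i ≅ M i) :
    IsDirectSum N V fun i => (α i).hom ≫ ι i := by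
  classical
  intro t
  let e : DirectSum Λ (fun i => ((N i).obj t : Type u)) ≃ₗ[k]
      DirectSum Λ (fun i => ((M i).obj t : Type u)) :=
    DFinsupp.mapRange.linearEquiv fun i => ((α i).app t).toLinearEquiv
  have key : (DirectSum.toModule k Λ (V.obj t) fun i => (((α i).hom ≫ ι i).app t).hom) =
      (DirectSum.toModule k Λ (V.obj t) fun i => ((ι i).app t).hom) ∘ₗ e.toLinearMap := by
    refine DirectSum.linearMap_ext k fun i => LinearMap.ext fun x => ?_
    have he : e (DirectSum.lof k Λ (fun i => ((N i).obj t : Type u)) i x) =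
        DirectSum.lof k Λ (fun i => ((M i).obj t : Type u)) i (((α i).hom.app t).hom x) :=
      DFinsupp.mapRange_single (hf := fun _ => map_zero _)
    rw [LinearMap.comp_apply, LinearMap.comp_apply, LinearMap.comp_apply, LinearEquiv.coe_coe, he,
      DirectSum.toModule_lof, DirectSum.toModule_lof]
    rfl
  have h1 := (H t).comp e.bijective
  rw [← LinearEquiv.coe_toLinearMap, ← LinearMap.coe_comp, ← key] at h1
  exact h1

end Isomorphisms

end Persistence

theorem mainTheorem3 {k : Type u} [Field k] {R : Type v} [LinearOrder R] [TopologicalSpace R]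
    [OrderTopology R] [TopologicalSpace.SeparableSpace R]
    (V : R ⥤ ModuleCat.{u} k) (hV : Persistence.HasDCC V) :
    (∃ (Λ : Type (max u v)) (J : Λ → Persistence.IntervalSet R)
        (ι : ∀ i, Persistence.intervalModule k (J i) ⟶ V),
        Persistence.IsDirectSum (fun i => Persistence.intervalModule k (J i)) V ι) ∧
    (∀ I : Persistence.IntervalSet R, Indecomposable (Persistence.intervalModule k I)) ∧
    ∀ (Λ : Type w) (M : Λ → (R ⥤ ModuleCat.{u} k)) (ι : ∀ i, M i ⟶ V),
      Persistence.IsDirectSum M V ι → (∀ i, Indecomposable (M i)) →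
      ∀ I : Persistence.IntervalSet R,
        Cardinal.lift.{max u v} (Cardinal.mk
            {i : Λ // Nonempty (M i ≅ Persistence.intervalModule k I)}) =
          Cardinal.lift.{w} (Module.rank k (Persistence.limQuotient V I)) := by
  refine ⟨Persistence.exists_isDirectSum_intervalModule hV,
    Persistence.indecomposable_intervalModule, fun Λ M ι H hM I => ?_⟩
  have hJ : ∀ i, ∃ J : Persistence.IntervalSet R,
      Nonempty (M i ≅ Persistence.intervalModule k J) := fun i => by
    obtain ⟨π, hπ⟩ := H.exists_retraction i
    exact Persistence.exists_iso_intervalModule (hV.of_retract hπ) (hM i)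
  choose J α using hJ
  have h := Persistence.mk_eq_rank_limQuotient hV (H.of_iso fun i => (α i).some.symm) I
  rw [← h]
  refine congrArg _ (Cardinal.mk_congr (Equiv.subtypeEquivRight fun i => ⟨?_, ?_⟩))
  · rintro ⟨e⟩
    exact Persistence.eq_of_intervalModule_iso ((α i).some.symm.trans e)
  · rintro rfl
    exact α i
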